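/- **Setting.** A rigid body with principal moments of inertia $I_2>I_1>I_3>0$ carries a rotor about its second body axis with internal angular momentum $h$ ($h=0$: rotor off). With angular momentum of constant size $l>0$, somersault angle $\phi$, tilt $\theta$ and twist $\psi$, the equations of motion are $$ \mathbf L-\begin{pmatrix}0\\h\\0\end{pmatrix} =\begin{pmatrix}I_1&&\\&I_2&\\&&I_3\end{pmatrix} \begin{pmatrix}\cos\theta\cos\psi&\sin\psi&0\\-\cos\theta\sin\psi&\cos\psi&0\\ \sin\theta&0&1\end{pmatrix} \begin{pmatrix}\dot\phi\\\dot\theta\\\dot\psi\end{pmatrix},\qquad \mathbf L=l\begin{pmatrix}\cos\theta\cos\psi\\-\cos\theta\sin\psi\\\sin\theta\end{pmatrix}. $$ Put $\delta=I_1/I_2-1<0$, $\gamma=I_1/I_3-1>0$, $\nu=\delta/\gamma$, and write $\hat T=lT/I_1$ for scaled times. A *dive* with rotor momentum $h\neq0$ is a motion, starting with $\theta=\psi=0$, in five successive stages: (1) rotor off, for a time $T_1\ge0$; (2) rotor on with momentum $h$, for a time $T_2$, until the tilt $|\theta|$ for the first time has its maximum along the rotor-on orbit; (3) rotor off; (4)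 rotor on with momentum $h$ or $-h$, until $\mathbf L=(\pm l,0,0)$ for the first time; (5) rotor off, for the same time $T_1$ as in stage 1. The total time is $T_{tot}$. The dive has $m$ somersaults and $n$ twists if the total change of $\phi$ is $2\pi m$ and the total change of $\psi$ has absolute value $2\pi n$. Let $\theta_{min},\theta_{max}$ be the extremal values of $|\theta|$ along the (full) rotor-off orbit of stage 3 and $s_\pm$ the sines: $s_-=\sin\theta_{min}$, $s_+=\sin\theta_{max}$. Let $\phi_2$ be the change of $\phi$ in stage 2, $P_3$ the period of $\mathbf L$ along the rotor-off orbit of stage 3 and $\Phi_3$ the change of $\phi$ in one such period. Let $$K(k^2)=\int_0^{\pi/2}\!\frac{dt}{\sqrt{1-k^2\sin^2t}},\qquad \Pi(n,k^2)=\int_0^{\pi/2}\!\frac{dt}{(1-n\sin^2t)\sqrt{1-k^2\sin^2t}}.$$ **Theorem.** For a dive with $m$ somersaults and $n$ twists in a total time $T_{tot}$ one has $0<s_-<1$, $s_+^2+(1-s_+^2)\nu=s_-^2$, $$\hat T_{tot}-2m\pi=2(\hat T_2-\phi_2)+(\hat P_3-\Phi_3)(n-\tfrac12),$$ $$2\hat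 T_1=2m\pi-2\phi_2-\Phi_3(n-\tfrac12)\ge0,$$ where the stage quantities are given as follows. Stage 2: with $\displaystyle k_2^2=\frac{(s_-^{-2}-1)(s_-^2(1-\nu)+\nu)}{(2-s_-^2)(1-\nu)}$ (which may be negative), $$\gamma\hat T_2=\frac{2}{s_-}\sqrt{\frac{1-s_-^2}{(2-s_-^2)(1-\nu)}}\;K(k_2^2),\qquad \phi_2=\hat T_2-\frac\pi2+f_+\Pi(n_+,k_2^2)+f_-\Pi(n_-,k_2^2),$$ $$n_\pm=1-s_-^{-2}\pm s_-^{-2}\sqrt{\frac{1-s_-^2}{1-\nu}},\qquad f_\pm=\frac{1-s_-^2\mp\sqrt{(1-s_-^2)(1-\nu)}}{s_-\sqrt{(1-s_-^2)(2-s_-^2)(1-\nu)}}.$$ Stage 3: with $\displaystyle k_3=\frac{s_+-s_-}{s_++s_-}$ and $\displaystyle s_+=\sqrt{\frac{s_-^2-\nu}{1-\nu}}$, $$\gamma\hat P_3=\frac{8}{(s_++s_-)\sqrt{1-\nu}}K(k_3^2),$$ $$\Phi_3-\hat P_3=\frac{8s_-}{(s_++s_-)\sqrt{1-\nu}}\Bigl(\Pi\bigl(k_3\tfrac{1-s_-}{1+s_-},k_3^2\bigr)-\Pi\bigl(k_3\tfrac{1+s_-}{1-s_-},k_3^2\bigr)\Bigr).$$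 -/

import Mathlib

open Real Set
open scoped Matrix

noncomputable section

namespace TwistingSomersault

/-! ### Legendre's complete elliptic integrals, as functions of the parameter `k²` -/

/-- Complete elliptic integral of the first kind `K(k²)`, with `x = k²`. -/
def ellipticK (x : ℝ) : ℝ :=
  ∫ t in (0 : ℝ)..(π / 2), 1 / √(1 - x * sin t ^ 2)

/-- Complete elliptic integral of the third kind `Π(n, k²)`, with `x = k²`. -/
def ellipticPi (n x : ℝ) : ℝ :=
  ∫ t in (0 : ℝ)..(π / 2), 1 / ((1 - n * sin t ^ 2) * √(1 - x * sin t ^ 2))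

/-! ### The rigid body with a rotor -/

/-- A motion in Euler angles, as functions of time: somersault angle `phi`, tilt angle `theta`
and twist angle `psi`. -/
structure Motion where
  phi : ℝ → ℝ
  theta : ℝ → ℝ
  psi : ℝ → ℝ

/-- The angular momentum vector in the body frame. -/
def bodyMomentum (l θ ψ : ℝ) : Fin 3 → ℝ :=
  ![l * (cos θ * cos ψ), l * (-(cos θ * sin ψ)), l * sin θ]

/-- The matrix that turns the rates of the Euler angles into the angular velocity in the
body frame. -/
def rateMatrix (θ ψ : ℝ) : Matrix (Fin 3) (Fin 3) ℝ :=
  !![cos θ * cos ψ, sin ψ, 0;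
     -(cos θ * sin ψ), cos ψ, 0;
     sin θ, 0, 1]

/-- On the time set `J`, the motion `q` satisfies the equations of motion of a rigid body with
principal moments of inertia `I₁, I₂, I₃` and angular momentum of size `l`, to which a rotor with
internal angular momentum `h` about the second body axis is attached (`h = 0`: rotor off). -/
def SolvesMotion (I₁ I₂ I₃ l h : ℝ) (q : Motion) (J : Set ℝ) : Prop :=
  ∀ t ∈ J, ∃ dφ dθ dψ : ℝ,
    HasDerivWithinAt q.phi dφ J t ∧ HasDerivWithinAt q.theta dθ J t ∧
    HasDerivWithinAt q.psi dψ J t ∧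
    bodyMomentum l (q.theta t) (q.psi t) - ![0, h, 0] =
      Matrix.diagonal ![I₁, I₂, I₃] *ᵥ (rateMatrix (q.theta t) (q.psi t) *ᵥ ![dφ, dθ, dψ])

/-- The sizes `|θ|` of the tilt that occur along the orbit through the point with tilt `θ₀` and
twist `ψ₀`, followed forwards and backwards in time, with constant rotor momentum `h`. -/
def orbitTilts (I₁ I₂ I₃ l h θ₀ ψ₀ : ℝ) : Set ℝ :=
  {x | ∃ (q : Motion) (a b : ℝ), SolvesMotion I₁ I₂ I₃ l h q (Icc a b) ∧
    ∃ s ∈ Icc a b, q.theta s = θ₀ ∧ q.psi s = ψ₀ ∧ ∃ t ∈ Icc a b, x = |q.theta t|}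

/-- `P` is the period of the body angular momentum along the rotor-off orbit through the point
with tilt `θ₀` and twist `ψ₀`, and `Φ` is the change of the somersault angle in one period. -/
def IsTwistPeriod (I₁ I₂ I₃ l θ₀ ψ₀ P Φ : ℝ) : Prop :=
  0 < P ∧ ∃ (q : Motion) (a : ℝ), SolvesMotion I₁ I₂ I₃ l 0 q (Icc a (a + P)) ∧
    (∃ s ∈ Icc a (a + P), q.theta s = θ₀ ∧ q.psi s = ψ₀) ∧
    bodyMomentum l (q.theta (a + P)) (q.psi (a + P)) = bodyMomentum l (q.theta a) (q.psi a) ∧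
    (∀ t ∈ Ioo a (a + P),
      bodyMomentum l (q.theta t) (q.psi t) ≠ bodyMomentum l (q.theta a) (q.psi a)) ∧
    q.phi (a + P) - q.phi a = Φ

/-- Pure somersaulting: the angular momentum points along the first body axis. -/
def IsPureSomersault (l θ ψ : ℝ) : Prop :=
  bodyMomentum l θ ψ = ![l, 0, 0] ∨ bodyMomentum l θ ψ = ![-l, 0, 0]

/-- A five-stage dive with rotor momentum of size `|h|`. It starts at time `0`, stage `i` ends at
time `tᵢ` for `i ≤ 4`, and the last stage ends at time `Ttot` and lasts as long as the first. -/
structure Dive (I₁ I₂ I₃ l h : ℝ) where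
  q : Motion
  t₁ : ℝ
  t₂ : ℝ
  t₃ : ℝ
  t₄ : ℝ
  Ttot : ℝ
  t₁_nonneg : 0 ≤ t₁
  t₁_le_t₂ : t₁ ≤ t₂
  t₂_le_t₃ : t₂ ≤ t₃
  t₃_le_t₄ : t₃ ≤ t₄
  stage₅_duration : Ttot - t₄ = t₁
  /-- Take-off in pure somersaulting motion. -/
  theta_start : q.theta 0 = 0
  psi_start : q.psi 0 = 0
  /-- Stage 1: rotor off. -/
  stage₁ : SolvesMotion I₁ I₂ I₃ l 0 q (Icc 0 t₁)
  /-- Stage 2: rotor on, until the tilt for the first time has its maximal size along the orbit. -/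
  stage₂ : SolvesMotion I₁ I₂ I₃ l h q (Icc t₁ t₂)
  stage₂_max : IsGreatest (orbitTilts I₁ I₂ I₃ l h (q.theta t₂) (q.psi t₂)) |q.theta t₂|
  stage₂_first : ∀ t ∈ Ico t₁ t₂, |q.theta t| < |q.theta t₂|
  /-- Stage 3: rotor off. -/
  stage₃ : SolvesMotion I₁ I₂ I₃ l 0 q (Icc t₂ t₃)
  /-- Stage 4: rotor on, in the same or in the opposite direction, until pure somersaulting is
  reached for the first time. -/
  stage₄ : ∃ h₄ : ℝ, (h₄ = h ∨ h₄ = -h) ∧ SolvesMotion I₁ I₂ I₃ l h₄ q (Icc t₃ t₄)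
  stage₄_end : IsPureSomersault l (q.theta t₄) (q.psi t₄)
  stage₄_first : ∀ t ∈ Ico t₃ t₄, ¬ IsPureSomersault l (q.theta t) (q.psi t)
  /-- Stage 5: rotor off. -/
  stage₅ : SolvesMotion I₁ I₂ I₃ l 0 q (Icc t₄ Ttot)

/-- The dive has `m` somersaults and `n` twists (in either direction of twist). -/
def Dive.Performs {I₁ I₂ I₃ l h : ℝ} (D : Dive I₁ I₂ I₃ l h) (m n : ℝ) : Prop :=
  D.q.phi D.Ttot - D.q.phi 0 = 2 * m * π ∧ |D.q.psi D.Ttot - D.q.psi 0| = 2 * n * π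

/-! ### The stage quantities

Here `s` stands for `s₋`. -/

/-- `s₊` in terms of `s₋`, from `s₊² + (1 - s₊²) ν = s₋²`. -/
def sPlus (ν s : ℝ) : ℝ := √((s ^ 2 - ν) / (1 - ν))

/-- The parameter `k²` of stage 3. -/
def param₃ (ν s : ℝ) : ℝ := ((sPlus ν s - s) / (sPlus ν s + s)) ^ 2

/-- The dimensionless period of the twisting motion. -/
def P₃hat (γ ν s : ℝ) : ℝ :=
  8 / (γ * (sPlus ν s + s) * √(1 - ν)) * ellipticK (param₃ ν s)

/-- The somersault angle per period of the twisting motion. -/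
def Φ₃ (γ ν s : ℝ) : ℝ :=
  P₃hat γ ν s + 8 * s / ((sPlus ν s + s) * √(1 - ν)) *
    (ellipticPi ((sPlus ν s - s) / (sPlus ν s + s) * ((1 - s) / (1 + s))) (param₃ ν s) -
      ellipticPi ((sPlus ν s - s) / (sPlus ν s + s) * ((1 + s) / (1 - s))) (param₃ ν s))

/-- The parameter `k²` of stage 2 (negative when `s² (1 - ν) + ν` is). -/
def param₂ (ν s : ℝ) : ℝ :=
  (1 / s ^ 2 - 1) * (s ^ 2 * (1 - ν) + ν) / ((2 - s ^ 2) * (1 - ν))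

/-- The dimensionless duration of stage 2. -/
def T₂hat (γ ν s : ℝ) : ℝ :=
  2 / (γ * s) * √((1 - s ^ 2) / ((2 - s ^ 2) * (1 - ν))) * ellipticK (param₂ ν s)

/-- The somersault angle acquired in stage 2. -/
def φ₂ (γ ν s : ℝ) : ℝ :=
  T₂hat γ ν s - π / 2 +
    1 / (s * √((1 - s ^ 2) * (2 - s ^ 2) * (1 - ν))) *
      ((1 - s ^ 2 - √((1 - s ^ 2) * (1 - ν))) *
          ellipticPi (1 - 1 / s ^ 2 + 1 / s ^ 2 * √((1 - s ^ 2) / (1 - ν))) (param₂ ν s) +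
        (1 - s ^ 2 + √((1 - s ^ 2) * (1 - ν))) *
          ellipticPi (1 - 1 / s ^ 2 - 1 / s ^ 2 * √((1 - s ^ 2) / (1 - ν))) (param₂ ν s))

end TwistingSomersault

end

open TwistingSomersault

/-!
In the body frame the direction `u = L / l` of the angular momentum satisfies the Euler equation,
a polynomial differential equation on the unit sphere, and the rate of the somersault angle is a
rational function of `u` (`SolvesMotion.hasDerivWithinAt_bodyDirection`,
`SolvesMotion.hasDerivWithinAt_phi`). Solutions of the Euler equation are unique, and one that
avoids the poles lifts to a motion in Euler angles (`exists_motion`).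

The orbits are conics in suitable projections, and both kinds that occur in a dive have explicit
global parametrizations `U(t)` by trigonometric functions and one square root: `offOrbit` for the
twisting motion with the rotor off and `onOrbit` for the orbit through pure somersaulting with the
rotor on. In both cases `w U' = F(U)` for the Euler field `F` and a positive clock `w`, so that
every motion on the orbit is `U ∘ α` with `α' = (l / I₁) w(α)` (`SolvesMotion.follows`). Therefore
times and somersault angles are integrals over `t`, and the tilts along the orbit are read off
from the third component of `U` (`orbitTilts_eq`).

The parameters are chosen such that `1 / w` is a constant times `1 / √(1 - k² sin² t)` with the
moduli in question; for `offOrbit` this is Gauss' transformation. Partial fractions in `sin² t`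
then give the complete integrals. In stage 3 the factors of `1 - u₃²` lead to the two integrals of
the third kind directly (`integral_offOrbit_rate`). In stage 2 the somersault angle is first
replaced by the angle of the second body axis around the angular momentum vector, whose rate has
the denominator `(1 - u₂) (1 + u₂)`; the difference of the two angles is elementary and changes by
`π / 2` (`hasDerivAt_axis_angle`, `integral_onOrbit_rate`).

For the dive itself: maximality of the tilt forces stage 2 to end at `u₁ = 0` after a quarter of
the rotor-on orbit. Since the energy of stage 4 is that of pure somersaulting, stage 3 has to end
at `u₁ = 0` as well, hence after `k` half periods, and stage 4 is again a quarter of a rotor-on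
orbit. The twist angle follows the orbit parameter up to less than a right angle, so the total
twist is `(k + 1) π`, that is, `n - 1 / 2 = k / 2`. Adding up the stages gives the two formulas.
-/

/-! ### Kinematics: the Euler angles and the direction of the body momentum -/

namespace TwistingSomersault

/-- The direction `L / l` of the angular momentum in the body frame. -/
noncomputable def bodyDirection (θ ψ : ℝ) : ℝ × ℝ × ℝ := (cos θ * cos ψ, -(cos θ * sin ψ), sin θ)

/-- The Euler equation for the momentum direction in the time scaled by `l / I₁`; the parameter
is `κ = (h / l) (I₁ / I₂)`. -/
noncomputable def eulerField (γ δ κ : ℝ) (u : ℝ × ℝ × ℝ) : ℝ × ℝ × ℝ :=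
  (u.2.2 * ((γ - δ) * u.2.1 + κ), -(γ * u.2.2 * u.1), u.1 * (δ * u.2.1 - κ))

/-- The rate of the somersault angle in scaled time, as a function of the momentum direction. -/
noncomputable def somersaultRate (δ κ : ℝ) (u : ℝ × ℝ × ℝ) : ℝ :=
  1 + (δ * u.2.1 ^ 2 - κ * u.2.1) / (1 - u.2.2 ^ 2)

theorem bodyMomentum_eq_iff {l : ℝ} (hl : l ≠ 0) (θ ψ θ' ψ' : ℝ) :
    bodyMomentum l θ ψ = bodyMomentum l θ' ψ' ↔ bodyDirection θ ψ = bodyDirection θ' ψ' := by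
  simp [bodyMomentum, bodyDirection, hl]

theorem isPureSomersault_iff {l : ℝ} (hl : l ≠ 0) (θ ψ : ℝ) :
    IsPureSomersault l θ ψ ↔ bodyDirection θ ψ = (1, 0, 0) ∨ bodyDirection θ ψ = (-1, 0, 0) := by
  have h1 : ∀ x : ℝ, l * x = l ↔ x = 1 := fun x => by
    rw [mul_eq_left₀ hl]
  have h2 : ∀ x : ℝ, l * x = -l ↔ x = -1 := fun x => by
    rw [← mul_right_inj' hl (b := x), mul_neg_one]
  simp [IsPureSomersault, bodyMomentum, bodyDirection, hl, h1, h2]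

theorem SolvesMotion.mono {I₁ I₂ I₃ l h : ℝ} {q : Motion} {J J' : Set ℝ}
    (H : SolvesMotion I₁ I₂ I₃ l h q J) (hJ : J' ⊆ J) : SolvesMotion I₁ I₂ I₃ l h q J' := by
  intro t ht
  obtain ⟨a, b, c, ha, hb, hc, he⟩ := H t (hJ ht)
  exact ⟨a, b, c, ha.mono hJ, hb.mono hJ, hc.mono hJ, he⟩

/-- The equations of motion written out in components. -/
theorem equations_of_motion_iff (I₁ I₂ I₃ l h θ ψ a b c : ℝ) :
    bodyMomentum l θ ψ - ![0, h, 0] =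
      Matrix.diagonal ![I₁, I₂, I₃] *ᵥ (rateMatrix θ ψ *ᵥ ![a, b, c]) ↔
    l * (cos θ * cos ψ) = I₁ * (cos θ * cos ψ * a + sin ψ * b) ∧
    l * (-(cos θ * sin ψ)) - h = I₂ * (-(cos θ * sin ψ) * a + cos ψ * b) ∧
    l * sin θ = I₃ * (sin θ * a + c) := by
  rw [funext_iff, Fin.forall_fin_succ, Fin.forall_fin_succ, Fin.forall_fin_succ]
  simp [bodyMomentum, rateMatrix, Matrix.mulVec, dotProduct,
    Fin.sum_univ_three, Matrix.diagonal]

section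

variable {I₁ I₂ I₃ l h γ δ κ : ℝ} {q : Motion} {J : Set ℝ}

theorem SolvesMotion.hasDerivWithinAt_bodyDirection (h₁ : I₁ ≠ 0) (h₂ : I₂ ≠ 0) (h₃ : I₃ ≠ 0)
    (hl : l ≠ 0) (hδ : δ = I₁ / I₂ - 1) (hγ : γ = I₁ / I₃ - 1) (hκ : κ = h / l * (I₁ / I₂))
    (H : SolvesMotion I₁ I₂ I₃ l h q J) {t : ℝ} (ht : t ∈ J) :
    HasDerivWithinAt (fun τ => bodyDirection (q.theta τ) (q.psi τ))
      ((l / I₁) • eulerField γ δ κ (bodyDirection (q.theta t) (q.psi t))) J t := by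
  obtain ⟨a, b, c, -, hb, hc, he⟩ := H t ht
  rw [equations_of_motion_iff] at he
  obtain ⟨e1, e2, e3⟩ := he
  have d := (hb.cos.mul hc.cos).prodMk ((hb.cos.mul hc.sin).neg.prodMk hb.sin)
  refine d.congr_deriv ?_
  set x := q.theta t
  set y := q.psi t
  have hy := sin_sq_add_cos_sq y
  have w1 : l / I₁ * (cos x * cos y) = cos x * cos y * a + sin y * b := by
    field_simp; linear_combination e1
  have w2 : l / I₁ * ((1 + δ) * (-(cos x * sin y)) - κ) = -(cos x * sin y) * a + cos y * b := by
    rw [hδ, hκ]; field_simp; linear_combination I₁ * e2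
  have w3 : l / I₁ * ((1 + γ) * sin x) = sin x * a + c := by
    rw [hγ]; field_simp; linear_combination I₁ * e3
  simp only [bodyDirection, eulerField, Prod.smul_mk, smul_eq_mul]
  refine Prod.ext ?_ (Prod.ext ?_ ?_)
  · simp only
    linear_combination sin x * w2 + (cos x * sin y) * w3
  · simp only
    linear_combination (-sin x) * w1 + (cos x * cos y) * w3
  · simp only
    linear_combination (-cos x * cos y) * w2 - (cos x * sin y) * w1 - (cos x * b) * hy

theorem SolvesMotion.hasDerivWithinAt_phi (h₁ : I₁ ≠ 0) (h₂ : I₂ ≠ 0)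
    (hl : l ≠ 0) (hδ : δ = I₁ / I₂ - 1) (hκ : κ = h / l * (I₁ / I₂))
    (H : SolvesMotion I₁ I₂ I₃ l h q J) {t : ℝ} (ht : t ∈ J) (h0 : cos (q.theta t) ≠ 0) :
    HasDerivWithinAt q.phi
      (l / I₁ * somersaultRate δ κ (bodyDirection (q.theta t) (q.psi t))) J t := by
  obtain ⟨a, b, c, ha, -, -, he⟩ := H t ht
  rw [equations_of_motion_iff] at he
  obtain ⟨e1, e2, -⟩ := he
  refine ha.congr_deriv ?_
  set x := q.theta t
  set y := q.psi t
  have hy := sin_sq_add_cos_sq y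
  have w1 : l / I₁ * (cos x * cos y) = cos x * cos y * a + sin y * b := by
    field_simp; linear_combination e1
  have w2 : l / I₁ * ((1 + δ) * (-(cos x * sin y)) - κ) = -(cos x * sin y) * a + cos y * b := by
    rw [hδ, hκ]; field_simp; linear_combination I₁ * e2
  have hx : 1 - sin x ^ 2 = cos x ^ 2 := by linear_combination -sin_sq_add_cos_sq x
  simp only [bodyDirection, somersaultRate, hx]
  have : a * cos x ^ 2 = l / I₁ * (cos x ^ 2 +
      (δ * (-(cos x * sin y)) ^ 2 - κ * (-(cos x * sin y)))) := by
    linear_combination (-cos x * cos y) * w1 + (cos x * sin y) * w2 +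
      (l / I₁ * cos x ^ 2 - cos x ^ 2 * a) * hy
  rw [← eq_div_iff (pow_ne_zero 2 h0)] at this
  rw [this]
  field_simp

/-- A nowhere vanishing differentiable plane curve has a differentiable polar angle, with any
admissible initial value. -/
theorem exists_polar_angle {x y x' y' : ℝ → ℝ} (hx : ∀ t, HasDerivAt x (x' t) t)
    (hy : ∀ t, HasDerivAt y (y' t) t) (hx' : Continuous x') (hy' : Continuous y')
    (h0 : ∀ t, x t ^ 2 + y t ^ 2 ≠ 0) {c r ψ₀ : ℝ} (hr : 0 < r) (hxc : x c = r * cos ψ₀)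
    (hyc : y c = r * sin ψ₀) :
    ∃ ψ : ℝ → ℝ, ψ c = ψ₀ ∧
      (∀ t, HasDerivAt ψ ((x t * y' t - y t * x' t) / (x t ^ 2 + y t ^ 2)) t) ∧
      ∀ t, x t = √(x t ^ 2 + y t ^ 2) * cos (ψ t) ∧ y t = √(x t ^ 2 + y t ^ 2) * sin (ψ t) := by
  have cx : Continuous x := continuous_iff_continuousAt.2 fun t => (hx t).continuousAt
  have cy : Continuous y := continuous_iff_continuousAt.2 fun t => (hy t).continuousAt
  -- `f` is the imaginary part of the logarithmic derivative of `x + i y`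
  let f : ℝ → ℝ := fun t => (x t * y' t - y t * x' t) / (x t ^ 2 + y t ^ 2)
  have cf : Continuous f := by
    refine Continuous.div (by fun_prop) (by fun_prop) h0
  let ψ : ℝ → ℝ := fun t => ψ₀ + ∫ τ in c..t, f τ
  have hψ : ∀ t, HasDerivAt ψ (f t) t := fun t =>
    (intervalIntegral.integral_hasDerivAt_right (cf.intervalIntegrable _ _)
      (cf.stronglyMeasurableAtFilter _ _) cf.continuousAt).const_add ψ₀
  have hψc : ψ c = ψ₀ := by simp [ψ]
  have hpos : ∀ t, 0 < x t ^ 2 + y t ^ 2 := fun t => lt_of_le_of_ne (by positivity) (h0 t).symm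
  let ρ : ℝ → ℝ := fun t => √(x t ^ 2 + y t ^ 2)
  have hρ : ∀ t, HasDerivAt ρ ((x t * x' t + y t * y' t) / ρ t) t := fun t => by
    refine ((((hx t).pow 2).add ((hy t).pow 2)).sqrt (h0 t)).congr_deriv ?_
    simp only [ρ, Pi.add_apply, Pi.pow_apply]
    have : √(x t ^ 2 + y t ^ 2) ≠ 0 := (sqrt_pos.2 (hpos t)).ne'
    field_simp
    push_cast
    ring
  have hρp : ∀ t, 0 < ρ t := fun t => sqrt_pos.2 (hpos t)
  have hρs : ∀ t, ρ t ^ 2 = x t ^ 2 + y t ^ 2 := fun t => sq_sqrt (hpos t).le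
  -- the curve turned back by `ψ` and scaled to unit length is constant
  have hA : ∀ t, HasDerivAt (fun t => (x t * cos (ψ t) + y t * sin (ψ t)) / ρ t) 0 t := by
    intro t
    refine ((((hx t).mul (hψ t).cos).add ((hy t).mul (hψ t).sin)).div (hρ t)
      (hρp t).ne').congr_deriv ?_
    have h1 := hρp t
    have h2 := hρs t
    have h3 := hpos t
    simp only [f, Pi.add_apply, Pi.mul_apply]
    rw [← h2]
    field_simp
    rw [h2]; ring
  have hB : ∀ t, HasDerivAt (fun t => (y t * cos (ψ t) - x t * sin (ψ t)) / ρ t) 0 t := by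
    intro t
    refine ((((hy t).mul (hψ t).cos).sub ((hx t).mul (hψ t).sin)).div (hρ t)
      (hρp t).ne').congr_deriv ?_
    have h1 := hρp t
    have h2 := hρs t
    have h3 := hpos t
    simp only [f, Pi.sub_apply, Pi.mul_apply]
    rw [← h2]
    field_simp
    rw [h2]; ring
  have hc := sin_sq_add_cos_sq ψ₀
  have hρc : ρ c = r := by
    have : x c ^ 2 + y c ^ 2 = r ^ 2 := by rw [hxc, hyc]; linear_combination r ^ 2 * hc
    simp only [ρ, this, sqrt_sq hr.le]
  refine ⟨ψ, hψc, hψ, fun t => ?_⟩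
  have eA := is_const_of_deriv_eq_zero (fun t => (hA t).differentiableAt)
    (fun t => (hA t).deriv) t c
  have eB := is_const_of_deriv_eq_zero (fun t => (hB t).differentiableAt)
    (fun t => (hB t).deriv) t c
  have vA : (x c * cos (ψ c) + y c * sin (ψ c)) / ρ c = 1 := by
    rw [hρc, hψc, hxc, hyc]; field_simp; linear_combination hc
  have vB : (y c * cos (ψ c) - x c * sin (ψ c)) / ρ c = 0 := by
    rw [hρc, hψc, hxc, hyc]; field_simp; ring

  rw [vA, div_eq_iff (hρp t).ne'] at eA
  rw [vB, div_eq_iff (hρp t).ne'] at eB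
  have ht := sin_sq_add_cos_sq (ψ t)
  constructor
  · change x t = ρ t * _
    linear_combination cos (ψ t) * eA - sin (ψ t) * eB - x t * ht
  · change y t = ρ t * _
    linear_combination sin (ψ t) * eA + cos (ψ t) * eB - y t * ht

/-- Every solution of the Euler equation that stays on the unit sphere away from the poles is
the momentum direction of a motion. -/
theorem exists_motion (h₁ : I₁ ≠ 0) (h₂ : I₂ ≠ 0) (h₃ : I₃ ≠ 0)
    (hl : l ≠ 0) (hδ : δ = I₁ / I₂ - 1) (hγ : γ = I₁ / I₃ - 1) (hκ : κ = h / l * (I₁ / I₂))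
    {u : ℝ → ℝ × ℝ × ℝ} (hu : ∀ t, HasDerivAt u ((l / I₁) • eulerField γ δ κ (u t)) t)
    (hsph : ∀ t, (u t).1 ^ 2 + (u t).2.1 ^ 2 + (u t).2.2 ^ 2 = 1)
    (hpole : ∀ t, (u t).2.2 ^ 2 < 1) {c θ₀ ψ₀ : ℝ} (hθ₀ : |θ₀| < π / 2)
    (hc : u c = bodyDirection θ₀ ψ₀) :
    ∃ q : Motion, q.theta c = θ₀ ∧ q.psi c = ψ₀ ∧
      (∀ t, q.theta t = arcsin (u t).2.2) ∧ ∀ J, SolvesMotion I₁ I₂ I₃ l h q J := by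
  obtain ⟨hθ1, hθ2⟩ := abs_lt.1 hθ₀
  have d1 : ∀ t, HasDerivAt (fun t => (u t).1) _ t := fun t => (hu t).fst
  have d2 : ∀ t, HasDerivAt (fun t => (u t).2.1) _ t := fun t => (hu t).snd.fst
  have d3 : ∀ t, HasDerivAt (fun t => (u t).2.2) _ t := fun t => (hu t).snd.snd
  simp only [eulerField, Prod.smul_mk, smul_eq_mul] at d1 d2 d3
  have c1 : Continuous (fun t => (u t).1) :=
    continuous_iff_continuousAt.2 fun t => (d1 t).continuousAt
  have c2 : Continuous (fun t => (u t).2.1) :=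
    continuous_iff_continuousAt.2 fun t => (d2 t).continuousAt
  have c3 : Continuous (fun t => (u t).2.2) :=
    continuous_iff_continuousAt.2 fun t => (d3 t).continuousAt
  have hr : ∀ t, (u t).1 ^ 2 + (-(u t).2.1) ^ 2 = 1 - (u t).2.2 ^ 2 := fun t => by
    linear_combination hsph t
  have hc1 : (u c).1 = cos θ₀ * cos ψ₀ := by rw [hc]; rfl
  have hc2 : (u c).2.1 = -(cos θ₀ * sin ψ₀) := by rw [hc]; rfl
  have hc3 : (u c).2.2 = sin θ₀ := by rw [hc]; rfl
  obtain ⟨ψ, hψc, hψ, hψu⟩ := exists_polar_angle (x := fun t => (u t).1)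
    (y := fun t => -(u t).2.1) d1 (fun t => (d2 t).neg) (by fun_prop) (by fun_prop)
    (fun t => by rw [hr]; linarith [hpole t]) (cos_pos_of_mem_Ioo ⟨by linarith, by linarith⟩)
    hc1 (by rw [hc2, neg_neg])
  have cg : Continuous (fun t => l / I₁ * somersaultRate δ κ (u t)) := by
    unfold somersaultRate
    refine Continuous.mul (by fun_prop) (Continuous.add (by fun_prop) (Continuous.div (by fun_prop)
      (by fun_prop) fun t => by linarith [hpole t]))
  refine ⟨⟨fun t => ∫ τ in c..t, l / I₁ * somersaultRate δ κ (u τ), fun t => arcsin (u t).2.2, ψ⟩,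
    ?_, hψc, fun t => rfl, ?_⟩
  · simp only [hc3]
    exact arcsin_sin (by linarith) (by linarith)
  · intro J t _
    have hp := hpole t
    have h1 : (u t).2.2 ≠ -1 := fun h => by rw [h] at hp; norm_num at hp
    have h2 : (u t).2.2 ≠ 1 := fun h => by rw [h] at hp; norm_num at hp
    refine ⟨_, _, _, (intervalIntegral.integral_hasDerivAt_right (cg.intervalIntegrable _ _)
      (cg.stronglyMeasurableAtFilter _ _) cg.continuousAt).hasDerivWithinAt,
      (HasDerivAt.comp (h₂ := arcsin) t (hasDerivAt_arcsin h1 h2) (d3 t)).hasDerivWithinAt,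
      (hψ t).hasDerivWithinAt, ?_⟩
    rw [equations_of_motion_iff]
    obtain ⟨v1, v2⟩ := hψu t
    rw [hr] at v1 v2
    have hq : 0 < 1 - (u t).2.2 ^ 2 := by linarith
    have v3 : sin (arcsin (u t).2.2) = (u t).2.2 := sin_arcsin (by nlinarith) (by nlinarith)
    simp only [hr, cos_arcsin, v3, somersaultRate]
    have hh : h = κ * l * I₂ / I₁ := by rw [hκ]; field_simp
    have hR : √(1 - (u t).2.2 ^ 2) ^ 2 = 1 - (u t).2.2 ^ 2 := sq_sqrt hq.le
    have hRp : 0 < √(1 - (u t).2.2 ^ 2) := sqrt_pos.2 hq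
    have hg3 : I₃ * (1 + γ) = I₁ := by rw [hγ]; field_simp; ring
    have hg2 : I₂ * (1 + δ) = I₁ := by rw [hδ]; field_simp; ring
    have hs := hsph t
    rw [← v1, ← v2]
    generalize √(1 - (u t).2.2 ^ 2) = R at *
    generalize (u t).1 = x at *
    generalize (u t).2.1 = y at *
    generalize (u t).2.2 = z at *
    have hC : cos (ψ t) = x / R := by rw [v1]; field_simp
    have hS : sin (ψ t) = -y / R := by rw [v2]; field_simp
    have hRR : R ^ 2 = x ^ 2 + y ^ 2 := by linear_combination hR - hs
    rw [hC, hS, ← hR]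
    refine ⟨?_, ?_, ?_⟩
    · field_simp
      ring
    · rw [hh]
      field_simp
      rw [hRR, ← hg2]; ring
    · field_simp
      rw [hRR, ← hg3]; ring

end

end TwistingSomersault

/-! ### Orbits of the Euler equation run through by a clock -/

namespace TwistingSomersault

theorem contDiff_eulerField (γ δ κ : ℝ) : ContDiff ℝ 1 (eulerField γ δ κ) := by
  unfold eulerField; fun_prop

/-- Uniqueness for the Euler equation, for solutions on the unit sphere. -/
theorem eulerField_unique {γ δ κ lam a b c : ℝ} {u v : ℝ → ℝ × ℝ × ℝ}
    (hu : ∀ t ∈ Icc a b, HasDerivWithinAt u (lam • eulerField γ δ κ (u t)) (Icc a b) t)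
    (hv : ∀ t ∈ Icc a b, HasDerivWithinAt v (lam • eulerField γ δ κ (v t)) (Icc a b) t)
    (hus : ∀ t, (u t).1 ^ 2 + (u t).2.1 ^ 2 + (u t).2.2 ^ 2 = 1)
    (hvs : ∀ t, (v t).1 ^ 2 + (v t).2.1 ^ 2 + (v t).2.2 ^ 2 = 1)
    (hc : c ∈ Icc a b) (huv : u c = v c) : EqOn u v (Icc a b) := by
  have hf : ContDiff ℝ 1 (fun x => lam • eulerField γ δ κ x) :=
    (contDiff_eulerField γ δ κ).const_smul lam
  obtain ⟨M, hM⟩ := (isCompact_closedBall (0 : ℝ × ℝ × ℝ) 1).exists_bound_of_continuousOn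
    (hf.continuous_fderiv one_ne_zero).continuousOn
  have hLip : LipschitzOnWith M.toNNReal (fun x => lam • eulerField γ δ κ x)
      (Metric.closedBall 0 1) := by
    refine (convex_closedBall 0 1).lipschitzOnWith_of_nnnorm_fderiv_le
      (fun x _ => (hf.differentiable one_ne_zero) x) fun x hx => ?_
    rw [← NNReal.coe_le_coe, coe_nnnorm]
    exact (hM x hx).trans (le_coe_toNNReal M)
  have hball : ∀ x : ℝ × ℝ × ℝ, x.1 ^ 2 + x.2.1 ^ 2 + x.2.2 ^ 2 = 1 →
      x ∈ Metric.closedBall (0 : ℝ × ℝ × ℝ) 1 := by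
    intro x hx
    rw [mem_closedBall_zero_iff, Prod.norm_def, Prod.norm_def]
    simp only [norm_eq_abs, max_le_iff, abs_le_one_iff_mul_self_le_one]
    refine ⟨?_, ?_, ?_⟩ <;> nlinarith [sq_nonneg x.1, sq_nonneg x.2.1, sq_nonneg x.2.2]
  have cu : ContinuousOn u (Icc a b) := fun t ht => (hu t ht).continuousWithinAt
  have cv : ContinuousOn v (Icc a b) := fun t ht => (hv t ht).continuousWithinAt
  have hR : EqOn u v (Icc c b) := by
    refine ODE_solution_unique_of_mem_Icc_right (v := fun _ x => lam • eulerField γ δ κ x)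
      (s := fun _ => Metric.closedBall 0 1) (fun _ _ => hLip)
      (cu.mono (Icc_subset_Icc_left hc.1)) (fun t ht => ?_) (fun t _ => hball _ (hus t))
      (cv.mono (Icc_subset_Icc_left hc.1)) (fun t ht => ?_) (fun t _ => hball _ (hvs t)) huv
    · exact (hu t ⟨hc.1.trans ht.1, ht.2.le⟩).mono_of_mem_nhdsWithin
        (Icc_mem_nhdsGE_of_mem ⟨hc.1.trans ht.1, ht.2⟩)
    · exact (hv t ⟨hc.1.trans ht.1, ht.2.le⟩).mono_of_mem_nhdsWithin
        (Icc_mem_nhdsGE_of_mem ⟨hc.1.trans ht.1, ht.2⟩)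
  have hL : EqOn u v (Icc a c) := by
    refine ODE_solution_unique_of_mem_Icc_left (v := fun _ x => lam • eulerField γ δ κ x)
      (s := fun _ => Metric.closedBall 0 1) (fun _ _ => hLip)
      (cu.mono (Icc_subset_Icc_right hc.2)) (fun t ht => ?_) (fun t _ => hball _ (hus t))
      (cv.mono (Icc_subset_Icc_right hc.2)) (fun t ht => ?_) (fun t _ => hball _ (hvs t)) huv
    · exact (hu t ⟨ht.1.le, ht.2.trans hc.2⟩).mono_of_mem_nhdsWithin
        (Icc_mem_nhdsLE_of_mem ⟨ht.1, ht.2.trans hc.2⟩)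
    · exact (hv t ⟨ht.1.le, ht.2.trans hc.2⟩).mono_of_mem_nhdsWithin
        (Icc_mem_nhdsLE_of_mem ⟨ht.1, ht.2.trans hc.2⟩)
  rw [← Icc_union_Icc_eq_Icc hc.1 hc.2]
  exact hL.union hR

/-- The autonomous scalar equation `α' = lam w(α)` with `w` positive and bounded has a global
increasing solution: the inverse of the function `x ↦ ∫ 1 / (lam w)`. -/
theorem exists_clock {w : ℝ → ℝ} (hw : Continuous w) (hw0 : ∀ t, 0 < w t) {M : ℝ}
    (hM : ∀ t, w t ≤ M) {lam : ℝ} (hlam : 0 < lam) (c t₀ : ℝ) :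
    ∃ α : ℝ → ℝ, α c = t₀ ∧ StrictMono α ∧ Function.Surjective α ∧
      ∀ τ, HasDerivAt α (lam * w (α τ)) τ := by
  have cg : Continuous (fun x => (lam * w x)⁻¹) :=
    (continuous_const.mul hw).inv₀ fun x => (mul_pos hlam (hw0 x)).ne'
  have hgpos : ∀ x, 0 < (lam * w x)⁻¹ := fun x => inv_pos.2 (mul_pos hlam (hw0 x))
  let T : ℝ → ℝ := fun x => c + ∫ y in t₀..x, (lam * w y)⁻¹
  have hT : ∀ x, HasDerivAt T (lam * w x)⁻¹ x := fun x =>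
    (intervalIntegral.integral_hasDerivAt_right (cg.intervalIntegrable _ _)
      (cg.stronglyMeasurableAtFilter _ _) cg.continuousAt).const_add c
  have hTmono : StrictMono T := strictMono_of_hasDerivAt_pos hT hgpos
  have hTc : Continuous T := continuous_iff_continuousAt.2 fun x => (hT x).continuousAt
  have hM0 : 0 < lam * M := mul_pos hlam ((hw0 0).trans_le (hM 0))
  -- `T x - x / (lam M)` is increasing, so `T` is unbounded in both directions
  have hmon : Monotone (fun x => T x - (lam * M)⁻¹ * x) := by
    refine monotone_of_hasDerivAt_nonneg (f' := fun x => (lam * w x)⁻¹ - (lam * M)⁻¹)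
      (fun x => ?_) fun x => ?_
    · exact ((hT x).sub ((hasDerivAt_id x).const_mul (lam * M)⁻¹)).congr_deriv (by ring)
    · rw [Pi.zero_apply, sub_nonneg]
      exact inv_anti₀ (mul_pos hlam (hw0 x)) (mul_le_mul_of_nonneg_left (hM x) hlam.le)
  have htop : Filter.Tendsto T Filter.atTop Filter.atTop := by
    refine Filter.tendsto_atTop_mono' _ ?_ (Filter.tendsto_atTop_add_const_left _ (T 0)
      (Filter.tendsto_id.const_mul_atTop (inv_pos.2 hM0)))
    filter_upwards [Filter.eventually_ge_atTop 0] with x hx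
    have := hmon hx
    simp only [mul_zero, id] at this ⊢
    linarith
  have hbot : Filter.Tendsto T Filter.atBot Filter.atBot := by
    refine Filter.tendsto_atBot_mono' _ ?_ (Filter.tendsto_atBot_add_const_left _ (T 0)
      (Filter.tendsto_id.const_mul_atBot (inv_pos.2 hM0)))
    filter_upwards [Filter.eventually_le_atBot 0] with x hx
    have := hmon hx
    simp only [mul_zero, id] at this ⊢
    linarith
  let e : ℝ ≃o ℝ := hTmono.orderIsoOfSurjective T (hTc.surjective htop hbot)
  have heT : ∀ x, e x = T x := fun x => rfl
  refine ⟨e.symm, ?_, e.symm.strictMono, e.symm.surjective, fun τ => ?_⟩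
  · rw [OrderIso.symm_apply_eq, heT]; simp [T]
  · have := HasDerivAt.of_local_left_inverse (f := T) (g := e.symm) (a := τ)
      e.symm.continuous.continuousAt (hT (e.symm τ)) (hgpos _).ne'
      (Filter.Eventually.of_forall fun y => by rw [← heT, OrderIso.apply_symm_apply])
    rwa [inv_inv] at this

/-- A function whose rate of change along a clock `α' = lam w(α)` is `lam w(α) g(α)` changes by
the integral of `g`. -/
theorem sub_eq_integral_of_clock {α w g f : ℝ → ℝ} {lam a b : ℝ}
    (hα : ∀ τ, HasDerivAt α (lam * w (α τ)) τ) (hg : Continuous g) (hab : a ≤ b)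
    (hf : ∀ τ ∈ Icc a b, HasDerivWithinAt f (lam * w (α τ) * g (α τ)) (Icc a b) τ) :
    f b - f a = ∫ x in α a..α b, g x := by
  let G : ℝ → ℝ := fun x => ∫ y in α a..x, g y
  have hG : ∀ x, HasDerivAt G (g x) x := fun x =>
    intervalIntegral.integral_hasDerivAt_right (hg.intervalIntegrable _ _)
      (hg.stronglyMeasurableAtFilter _ _) hg.continuousAt
  have h0 : ∀ τ ∈ Icc a b, HasDerivWithinAt (fun τ => f τ - G (α τ)) 0 (Icc a b) τ := by
    intro τ hτ
    refine ((hf τ hτ).sub ((hG (α τ)).comp τ (hα τ)).hasDerivWithinAt).congr_deriv ?_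
    ring
  have := constant_of_has_deriv_right_zero (fun τ hτ => (h0 τ hτ).continuousWithinAt)
    (fun τ hτ => (h0 τ (Ico_subset_Icc_self hτ)).mono_of_mem_nhdsWithin
      (Icc_mem_nhdsGE_of_mem hτ)) b (right_mem_Icc.2 hab)
  simp only [G, intervalIntegral.integral_same] at this
  linarith

/-- `U` runs through an orbit of the Euler equation on the unit sphere that avoids the poles,
with speed `1 / w` with respect to scaled time. -/
structure IsEulerOrbit (γ δ κ : ℝ) (U : ℝ → ℝ × ℝ × ℝ) (w : ℝ → ℝ) : Prop where
  hasDerivAt : ∀ t, HasDerivAt U ((w t)⁻¹ • eulerField γ δ κ (U t)) t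
  sphere : ∀ t, (U t).1 ^ 2 + (U t).2.1 ^ 2 + (U t).2.2 ^ 2 = 1
  pole : ∀ t, (U t).2.2 ^ 2 < 1
  clock_continuous : Continuous w
  clock_pos : ∀ t, 0 < w t
  clock_bdd : ∃ M, ∀ t, w t ≤ M

theorem bodyDirection_sphere (θ ψ : ℝ) : (bodyDirection θ ψ).1 ^ 2 + (bodyDirection θ ψ).2.1 ^ 2 +
    (bodyDirection θ ψ).2.2 ^ 2 = 1 := by
  simp only [bodyDirection]
  linear_combination sin_sq_add_cos_sq θ + cos θ ^ 2 * sin_sq_add_cos_sq ψ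

theorem IsEulerOrbit.hasDerivAt_comp {γ δ κ lam : ℝ} {U : ℝ → ℝ × ℝ × ℝ} {w α : ℝ → ℝ}
    (hU : IsEulerOrbit γ δ κ U w) (hα : ∀ τ, HasDerivAt α (lam * w (α τ)) τ) (τ : ℝ) :
    HasDerivAt (fun τ => U (α τ)) (lam • eulerField γ δ κ (U (α τ))) τ := by
  refine ((hU.hasDerivAt (α τ)).scomp τ (hα τ)).congr_deriv ?_
  rw [smul_smul, mul_assoc, mul_inv_cancel₀ (hU.clock_pos _).ne', mul_one]

theorem IsEulerOrbit.continuous {γ δ κ : ℝ} {U : ℝ → ℝ × ℝ × ℝ} {w : ℝ → ℝ}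
    (hU : IsEulerOrbit γ δ κ U w) : Continuous U :=
  continuous_iff_continuousAt.2 fun t => (hU.hasDerivAt t).continuousAt

theorem IsEulerOrbit.continuous_somersaultRate {γ δ κ : ℝ} {U : ℝ → ℝ × ℝ × ℝ} {w : ℝ → ℝ}
    (hU : IsEulerOrbit γ δ κ U w) : Continuous fun t => somersaultRate δ κ (U t) := by
  have := hU.continuous
  unfold somersaultRate
  exact continuous_const.add (Continuous.div (by fun_prop) (by fun_prop)
    fun t => by linarith [hU.pole t])

/-- A clock `α` on a piece of a motion, which shows the position along the orbit `U`. -/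
structure Follows (q : Motion) (lam : ℝ) (U : ℝ → ℝ × ℝ × ℝ) (w α : ℝ → ℝ) (a b : ℝ) : Prop where
  strictMono : StrictMono α
  surjective : Function.Surjective α
  hasDerivAt : ∀ τ, HasDerivAt α (lam * w (α τ)) τ
  eq : ∀ τ ∈ Icc a b, bodyDirection (q.theta τ) (q.psi τ) = U (α τ)

section

variable {I₁ I₂ I₃ l h γ δ κ : ℝ} {q : Motion} {U : ℝ → ℝ × ℝ × ℝ} {w α : ℝ → ℝ} {a b c t₀ : ℝ}

theorem SolvesMotion.follows (h₁ : 0 < I₁) (h₂ : I₂ ≠ 0) (h₃ : I₃ ≠ 0)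
    (hl : 0 < l) (hδ : δ = I₁ / I₂ - 1) (hγ : γ = I₁ / I₃ - 1) (hκ : κ = h / l * (I₁ / I₂))
    (H : SolvesMotion I₁ I₂ I₃ l h q (Icc a b)) (hU : IsEulerOrbit γ δ κ U w) (hc : c ∈ Icc a b)
    (ht₀ : bodyDirection (q.theta c) (q.psi c) = U t₀) :
    ∃ α, α c = t₀ ∧ Follows q (l / I₁) U w α a b := by
  obtain ⟨M, hM⟩ := hU.clock_bdd
  obtain ⟨α, hαc, hmono, hsurj, hα⟩ := exists_clock hU.clock_continuous hU.clock_pos hM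
    (div_pos hl h₁) c t₀
  refine ⟨α, hαc, hmono, hsurj, hα, ?_⟩
  refine eulerField_unique (v := fun τ => U (α τ))
    (fun t ht => H.hasDerivWithinAt_bodyDirection h₁.ne' h₂ h₃ hl.ne' hδ hγ hκ ht)
    (fun t _ => (hU.hasDerivAt_comp hα t).hasDerivWithinAt)
    (fun t => bodyDirection_sphere _ _) (fun t => hU.sphere _) hc ?_
  rw [ht₀, hαc]

theorem Follows.duration (F : Follows q (l / I₁) U w α a b) (hU : IsEulerOrbit γ δ κ U w)
    (hab : a ≤ b) : l / I₁ * (b - a) = ∫ x in α a..α b, (w x)⁻¹ := by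
  rw [← sub_eq_integral_of_clock (f := fun τ => l / I₁ * τ) (g := fun x => (w x)⁻¹) F.hasDerivAt
    (hU.clock_continuous.inv₀ fun t => (hU.clock_pos t).ne') hab ?_]
  · ring
  · intro τ _
    rw [mul_assoc, mul_inv_cancel₀ (hU.clock_pos _).ne']
    exact ((hasDerivAt_id τ).const_mul _).hasDerivWithinAt

theorem Follows.somersault (F : Follows q (l / I₁) U w α a b) (hU : IsEulerOrbit γ δ κ U w)
    (h₁ : I₁ ≠ 0) (h₂ : I₂ ≠ 0) (hl : l ≠ 0) (hδ : δ = I₁ / I₂ - 1) (hκ : κ = h / l * (I₁ / I₂))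
    (H : SolvesMotion I₁ I₂ I₃ l h q (Icc a b)) (hab : a ≤ b) :
    q.phi b - q.phi a = ∫ x in α a..α b, somersaultRate δ κ (U x) * (w x)⁻¹ := by
  refine sub_eq_integral_of_clock F.hasDerivAt (hU.continuous_somersaultRate.mul
    (hU.clock_continuous.inv₀ fun t => (hU.clock_pos t).ne')) hab fun τ hτ => ?_
  have e := F.eq τ hτ
  have hcos : cos (q.theta τ) ≠ 0 := by
    have hp := hU.pole (α τ)
    rw [← e] at hp
    intro h0
    have := sin_sq_add_cos_sq (q.theta τ)
    rw [h0] at this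
    simp only [bodyDirection] at hp
    nlinarith
  refine (H.hasDerivWithinAt_phi h₁ h₂ hl hδ hκ hτ hcos).congr_deriv ?_
  rw [e]
  field_simp [(hU.clock_pos (α τ)).ne']

/-- A continuous angle whose cosine has no zero stays in the interval `(-π/2, π/2)`. -/
theorem abs_lt_of_cos_ne_zero {f : ℝ → ℝ} (hf : ContinuousOn f (Icc a b))
    (h0 : ∀ t ∈ Icc a b, cos (f t) ≠ 0) (hc : c ∈ Icc a b) (hfc : |f c| < π / 2) :
    ∀ t ∈ Icc a b, |f t| < π / 2 := by
  intro t ht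
  by_contra! hcon
  have hcont : ContinuousOn (fun t => |f t|) (uIcc c t) :=
    (hf.mono (uIcc_subset_Icc hc ht)).abs
  obtain ⟨x, hx, hfx⟩ := intermediate_value_uIcc hcont (mem_uIcc.2 (.inl ⟨hfc.le, hcon⟩))
  refine h0 x (uIcc_subset_Icc hc ht hx) ?_
  rw [← cos_abs]
  simp only at hfx
  rw [hfx, cos_pi_div_two]

theorem SolvesMotion.continuousOn_theta (H : SolvesMotion I₁ I₂ I₃ l h q (Icc a b)) :
    ContinuousOn q.theta (Icc a b) := fun t ht => by
  obtain ⟨_, _, _, _, hb, _⟩ := H t ht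
  exact hb.continuousWithinAt

theorem SolvesMotion.continuousOn_psi (H : SolvesMotion I₁ I₂ I₃ l h q (Icc a b)) :
    ContinuousOn q.psi (Icc a b) := fun t ht => by
  obtain ⟨_, _, _, _, _, hc, _⟩ := H t ht
  exact hc.continuousWithinAt

/-- The tilt stays in `(-π/2, π/2)` along an orbit that avoids the poles. -/
theorem Follows.abs_theta_lt (F : Follows q (l / I₁) U w α a b) (hU : IsEulerOrbit γ δ κ U w)
    (H : SolvesMotion I₁ I₂ I₃ l h q (Icc a b)) (hc : c ∈ Icc a b) (hθ : |q.theta c| < π / 2) :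
    ∀ t ∈ Icc a b, |q.theta t| < π / 2 := by
  refine abs_lt_of_cos_ne_zero H.continuousOn_theta (fun t ht h0 => ?_) hc hθ
  have hp := hU.pole (α t)
  rw [← F.eq t ht] at hp
  have := sin_sq_add_cos_sq (q.theta t)
  rw [h0] at this
  simp only [bodyDirection] at hp
  nlinarith

/-- The sizes of the tilt along an orbit that avoids the poles. -/
theorem orbitTilts_eq (h₁ : 0 < I₁) (h₂ : I₂ ≠ 0) (h₃ : I₃ ≠ 0)
    (hl : 0 < l) (hδ : δ = I₁ / I₂ - 1) (hγ : γ = I₁ / I₃ - 1) (hκ : κ = h / l * (I₁ / I₂))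
    (hU : IsEulerOrbit γ δ κ U w) {θ₀ ψ₀ : ℝ} (hθ₀ : |θ₀| < π / 2)
    (ht₀ : bodyDirection θ₀ ψ₀ = U t₀) :
    orbitTilts I₁ I₂ I₃ l h θ₀ ψ₀ = range fun t => arcsin |(U t).2.2| := by
  have habs : ∀ x, |arcsin x| = arcsin |x| := fun x => by
    rcases le_total 0 x with hx | hx
    · rw [abs_of_nonneg hx, abs_of_nonneg (arcsin_nonneg.2 hx)]
    · rw [abs_of_nonpos hx, abs_of_nonpos (arcsin_nonpos.2 hx), arcsin_neg]
  ext x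
  constructor
  · rintro ⟨q, a, b, H, s, hs, hθs, hψs, t, ht, rfl⟩
    obtain ⟨α, -, F⟩ := H.follows h₁ h₂ h₃ hl hδ hγ hκ hU hs (by rw [hθs, hψs, ht₀])
    have hθ := abs_lt.1 (F.abs_theta_lt hU H hs (by rwa [hθs]) t ht)
    refine ⟨α t, ?_⟩
    simp only [← F.eq t ht, ← habs, bodyDirection]
    rw [arcsin_sin (by linarith) (by linarith)]
  · rintro ⟨t, rfl⟩
    obtain ⟨M, hM⟩ := hU.clock_bdd
    obtain ⟨α, hα0, hmono, hsurj, hα⟩ := exists_clock hU.clock_continuous hU.clock_pos hM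
      (div_pos hl h₁) 0 t₀
    obtain ⟨q, hq1, hq2, hq3, H⟩ := exists_motion h₁.ne' h₂ h₃ hl.ne' hδ hγ hκ
      (hU.hasDerivAt_comp hα) (fun t => hU.sphere _) (fun t => hU.pole _) (c := 0) hθ₀
      (by rw [hα0, ht₀])
    obtain ⟨τ, rfl⟩ := hsurj t
    refine ⟨q, min 0 τ, max 0 τ, H _, 0, ⟨min_le_left _ _, le_max_left _ _⟩, hq1, hq2, τ,
      ⟨min_le_right _ _, le_max_right _ _⟩, ?_⟩
    rw [hq3, habs]

/-- If the directions of two continuous angles `f` and `β` always include an acute angle, and the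
angles agree at one time, then they agree whenever their directions are parallel. -/
theorem angle_eq_of_cos_sub_pos {f β : ℝ → ℝ} (hf : ContinuousOn f (Icc a b))
    (hβ : ContinuousOn β (Icc a b)) (hpos : ∀ t ∈ Icc a b, 0 < cos (f t - β t)) (hc : c ∈ Icc a b)
    (hfc : f c = β c) {d : ℝ} (hd : d ∈ Icc a b) (hsin : sin (f d - β d) = 0) : f d = β d := by
  have h := abs_lt.1 (abs_lt_of_cos_ne_zero (hf.sub hβ) (fun t ht => (hpos t ht).ne') hc
    (by rw [Pi.sub_apply, hfc, sub_self, abs_zero]; positivity) d hd)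
  simp only [Pi.sub_apply] at h
  have := (sin_eq_zero_iff_of_lt_of_lt (by linarith [pi_pos]) (by linarith [pi_pos])).1 hsin
  linarith

end

end TwistingSomersault

/-! ### Explicit parametrizations of the two kinds of orbits -/

namespace TwistingSomersault

/-- The constants of a twisting orbit: `s` and `p` are the sines `s₋` and `s₊` of the extremal
tilts, `e` is the largest size of the second component of the momentum direction, and `b` stands
for `√(1 - δ / γ)`. -/
structure TwistConstants (γ δ s e p b : ℝ) : Prop where
  hγ : 0 < γ
  hδ : δ < 0
  hs : 0 < s
  he : 0 < e
  hp : 0 < p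
  hb : 0 < b
  b_sq : γ * b ^ 2 = γ - δ
  s_sq : 1 - s ^ 2 = e ^ 2 * b ^ 2
  p_sq : p ^ 2 + e ^ 2 = 1

section

variable {γ δ s e p b : ℝ}

theorem TwistConstants.p_lt_one (A : TwistConstants γ δ s e p b) : p < 1 := by
  nlinarith [A.p_sq, A.hp, pow_pos A.he 2]

theorem TwistConstants.e_lt_one (A : TwistConstants γ δ s e p b) : e < 1 := by
  nlinarith [A.p_sq, A.he, pow_pos A.hp 2]

/-- The energy at the smallest tilt, where `u₂ = 0`, equals that at the largest, where
`|u₂| = e`. -/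
theorem TwistConstants.p_sq_sub_s_sq (A : TwistConstants γ δ s e p b) :
    γ * (p ^ 2 - s ^ 2) = -δ * e ^ 2 := by
  linear_combination γ * A.p_sq + γ * A.s_sq + e ^ 2 * A.b_sq

theorem TwistConstants.s_lt_p (A : TwistConstants γ δ s e p b) : s < p := by
  have h1 : 0 < γ * (p ^ 2 - s ^ 2) := by
    rw [A.p_sq_sub_s_sq]; exact mul_pos (neg_pos.2 A.hδ) (pow_pos A.he 2)
  have := (pos_iff_pos_of_mul_pos h1).1 A.hγ
  nlinarith [A.hs, A.hp]

theorem TwistConstants.s_lt_one (A : TwistConstants γ δ s e p b) : s < 1 :=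
  A.s_lt_p.trans A.p_lt_one

/-- The radicand of the clock of the rotor-off orbit. -/
noncomputable def offRad (s p t : ℝ) : ℝ := (p + s) ^ 2 - (p - s) ^ 2 * sin t ^ 2

/-- The common denominator of the components of the rotor-off orbit. -/
noncomputable def offDen (s p t : ℝ) : ℝ := p + s - (p - s) * sin t ^ 2

/-- The rotor-off orbit around the third axis (`σ = 1`) or its opposite (`σ = -1`), in the
parameter of Gauss' transformation, in which the clock has the modulus
`(s₊ - s₋) / (s₊ + s₋)`. -/
noncomputable def offOrbit (s e p b σ t : ℝ) : ℝ × ℝ × ℝ :=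
  (e * b * cos t * √(offRad s p t) / offDen s p t, -(2 * σ * e * s * sin t / offDen s p t),
    σ * s * (p + s + (p - s) * sin t ^ 2) / offDen s p t)

/-- The clock of the rotor-off orbit. -/
noncomputable def offClock (γ b s p t : ℝ) : ℝ := γ * b * √(offRad s p t) / 2

theorem offRad_pos (hs : 0 < s) (hp : 0 < p) (t : ℝ) : 0 < offRad s p t := by
  unfold offRad
  have h := sin_sq_le_one t
  nlinarith [mul_pos hs hp, mul_nonneg (sq_nonneg (p - s)) (sub_nonneg.2 h)]

theorem offDen_pos (hs : 0 < s) (hp : 0 < p) (t : ℝ) : 0 < offDen s p t := by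
  unfold offDen
  have := cos_sq_add_sin_sq t
  rw [show p + s - (p - s) * sin t ^ 2 = p * cos t ^ 2 + s * (1 + sin t ^ 2) by
    linear_combination -p * this]
  positivity

theorem hasDerivAt_offRad (s p t : ℝ) :
    HasDerivAt (offRad s p) (-(2 * (p - s) ^ 2 * sin t * cos t)) t := by
  refine ((((hasDerivAt_sin t).pow 2).const_mul ((p - s) ^ 2)).const_sub ((p + s) ^ 2)).congr_deriv
    ?_
  ring

theorem hasDerivAt_offDen (s p t : ℝ) :
    HasDerivAt (offDen s p) (-(2 * (p - s) * sin t * cos t)) t := by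
  refine ((((hasDerivAt_sin t).pow 2).const_mul (p - s)).const_sub (p + s)).congr_deriv ?_
  ring

theorem offOrbit_sphere (A : TwistConstants γ δ s e p b) {σ : ℝ} (hσ : σ ^ 2 = 1) (t : ℝ) :
    (offOrbit s e p b σ t).1 ^ 2 + (offOrbit s e p b σ t).2.1 ^ 2 +
      (offOrbit s e p b σ t).2.2 ^ 2 = 1 := by
  have hD := offDen_pos A.hs A.hp t
  have hR := sq_sqrt (offRad_pos A.hs A.hp t).le
  simp only [offOrbit]
  field_simp
  rw [hR, hσ, cos_sq']
  unfold offRad offDen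
  have h1 : e ^ 2 = 1 - p ^ 2 := by linear_combination A.p_sq
  have h2 : (1 - p ^ 2) * b ^ 2 = 1 - s ^ 2 := by rw [← h1]; exact A.s_sq.symm
  rw [h1]
  linear_combination ((1 - sin t ^ 2) * ((p + s) ^ 2 - (p - s) ^ 2 * sin t ^ 2)) * h2

theorem isEulerOrbit_offOrbit (A : TwistConstants γ δ s e p b) {σ : ℝ} (hσ : σ ^ 2 = 1) :
    IsEulerOrbit γ δ 0 (offOrbit s e p b σ) (offClock γ b s p) where
  sphere := offOrbit_sphere A hσ
  pole t := by
    have hD := offDen_pos A.hs A.hp t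
    have h1 : σ * s * (p + s + (p - s) * sin t ^ 2) / offDen s p t =
      σ * (s * (p + s + (p - s) * sin t ^ 2) / offDen s p t) := by ring
    simp only [offOrbit]
    rw [h1, mul_pow, hσ, one_mul, sq_lt_one_iff₀, div_lt_one hD]
    · unfold offDen
      have := sin_sq_le_one t
      nlinarith [A.hs, A.hp, A.p_lt_one, A.s_lt_p, A.s_lt_one, sq_nonneg (sin t),
        mul_nonneg (sub_nonneg.2 A.s_lt_p.le) (sub_nonneg.2 this),
        mul_nonneg (mul_nonneg A.hs.le (sub_nonneg.2 A.p_lt_one.le)) (sub_nonneg.2 this)]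
    · have := A.s_lt_p
      have := A.hs
      have := A.hp
      have : 0 < p - s := by linarith
      positivity
  clock_continuous := by unfold offClock offRad; fun_prop
  clock_pos t := by
    have := sqrt_pos.2 (offRad_pos A.hs A.hp t)
    have := A.hγ
    have := A.hb
    unfold offClock; positivity
  clock_bdd := by
    refine ⟨γ * b * √((p + s) ^ 2) / 2, fun t => ?_⟩
    have := A.hγ
    have := A.hb
    unfold offClock
    gcongr
    unfold offRad
    nlinarith [mul_nonneg (sq_nonneg (p - s)) (sq_nonneg (sin t))]
  hasDerivAt t := by
    have hD := offDen_pos A.hs A.hp t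
    have hR0 := offRad_pos A.hs A.hp t
    have hR := sq_sqrt hR0.le
    have hRp := sqrt_pos.2 hR0
    have dD := hasDerivAt_offDen s p t
    have dR := (hasDerivAt_offRad s p t).sqrt hR0.ne'
    have d1 := (((hasDerivAt_cos t).const_mul (e * b)).mul dR).div dD hD.ne'
    have d2 := (((hasDerivAt_sin t).const_mul (2 * σ * e * s)).div dD hD.ne').neg
    have d3 := (((((hasDerivAt_sin t).pow 2).const_mul (p - s)).const_add (p + s)).const_mul
      (σ * s)).div dD hD.ne'
    refine (d1.prodMk (d2.prodMk d3)).congr_deriv ?_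
    have hγ := A.hγ
    have hb := A.hb
    have hC := cos_sq' t
    have hDe : offDen s p t = p + s - (p - s) * sin t ^ 2 := rfl
    have hRe : √(offRad s p t) ^ 2 = (p + s) ^ 2 - (p - s) ^ 2 * sin t ^ 2 := hR
    simp only [offOrbit, offClock, eulerField, Prod.smul_mk, smul_eq_mul, Pi.mul_apply, Pi.pow_apply]
    generalize offDen s p t = D at *
    generalize √(offRad s p t) = R at *
    refine Prod.ext ?_ (Prod.ext ?_ ?_)
    · simp only
      have hg : γ - δ = γ * b ^ 2 := A.b_sq.symm
      rw [hg]
      field_simp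
      rw [hC, hRe, hDe]
      linear_combination (4 * e * b ^ 2 * s ^ 2 * γ * sin t * (p + s + sin t ^ 2 * (p - s))) * hσ
    · simp only
      field_simp
      rw [hDe]
      ring
    · simp only
      have hg : δ * e ^ 2 = - γ * (p ^ 2 - s ^ 2) := by linear_combination A.p_sq_sub_s_sq
      field_simp
      rw [hDe]
      push_cast
      linear_combination (4 * σ * s * cos t * sin t) * hg

/-- The radicand of the clock of the rotor-on orbit. -/
noncomputable def onRad (s p t : ℝ) : ℝ := s ^ 2 * (2 - s ^ 2) * cos t ^ 2 + p ^ 2 * sin t ^ 2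

/-- The common denominator of the components of the rotor-on orbit. -/
noncomputable def onDen (s p t : ℝ) : ℝ := s ^ 2 * cos t ^ 2 + p ^ 2 * sin t ^ 2

/-- The rotor-on orbit through the points of pure somersaulting, where the rotor momentum has the
sign `ε` and the parameter `t = 0` is one of the points of maximal tilt, which has the sign
`σ`. -/
noncomputable def onOrbit (s e p σ ε t : ℝ) : ℝ × ℝ × ℝ :=
  (σ * ε * p * sin t * √(onRad s p t) / onDen s p t, ε * e * s ^ 2 * cos t ^ 2 / onDen s p t,
    σ * p * s ^ 2 * cos t / onDen s p t)

/-- The clock of the rotor-on orbit. -/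
noncomputable def onClock (γ s e p t : ℝ) : ℝ := γ * √(onRad s p t) / (2 * e)

theorem onDen_pos (hs : 0 < s) (hp : 0 < p) (t : ℝ) : 0 < onDen s p t := by
  unfold onDen
  have h := cos_sq_add_sin_sq t
  rcases eq_or_ne (sin t) 0 with h0 | h0
  · rw [h0] at h ⊢
    have : cos t ^ 2 = 1 := by linarith
    rw [this]; positivity
  · positivity

theorem onRad_pos (hs : 0 < s) (hs1 : s < 1) (hp : 0 < p) (t : ℝ) : 0 < onRad s p t := by
  have h := onDen_pos hs hp t
  unfold onDen at h
  unfold onRad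
  nlinarith [mul_nonneg (mul_nonneg (sq_nonneg s) (sq_nonneg (cos t)))
    (show (0 : ℝ) ≤ 1 - s ^ 2 by nlinarith)]

theorem hasDerivAt_onDen (s p t : ℝ) :
    HasDerivAt (onDen s p) (2 * (p ^ 2 - s ^ 2) * sin t * cos t) t := by
  refine ((((hasDerivAt_cos t).pow 2).const_mul (s ^ 2)).add
    (((hasDerivAt_sin t).pow 2).const_mul (p ^ 2))).congr_deriv ?_
  ring

theorem hasDerivAt_onRad (s p t : ℝ) :
    HasDerivAt (onRad s p) (2 * (p ^ 2 - s ^ 2 * (2 - s ^ 2)) * sin t * cos t) t := by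
  refine ((((hasDerivAt_cos t).pow 2).const_mul (s ^ 2 * (2 - s ^ 2))).add
    (((hasDerivAt_sin t).pow 2).const_mul (p ^ 2))).congr_deriv ?_
  ring

theorem onOrbit_sphere (A : TwistConstants γ δ s e p b) {σ ε : ℝ} (hσ : σ ^ 2 = 1)
    (hε : ε ^ 2 = 1) (t : ℝ) :
    (onOrbit s e p σ ε t).1 ^ 2 + (onOrbit s e p σ ε t).2.1 ^ 2 +
      (onOrbit s e p σ ε t).2.2 ^ 2 = 1 := by
  have hD := onDen_pos A.hs A.hp t
  have hR := sq_sqrt (onRad_pos A.hs A.s_lt_one A.hp t).le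
  simp only [onOrbit]
  field_simp
  rw [hR, hσ, hε, sin_sq t]
  unfold onRad onDen
  have h1 : e ^ 2 = 1 - p ^ 2 := by linear_combination A.p_sq
  rw [h1, sin_sq t]
  ring

theorem isEulerOrbit_onOrbit (A : TwistConstants γ δ s e p b) {σ ε κ : ℝ} (hσ : σ ^ 2 = 1)
    (hε : ε ^ 2 = 1) (hκ : 2 * κ * e = γ * s ^ 2) :
    IsEulerOrbit γ δ (ε * κ) (onOrbit s e p σ ε) (onClock γ s e p) where
  sphere := onOrbit_sphere A hσ hε
  pole t := by
    have hD := onDen_pos A.hs A.hp t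
    have hs := A.hs
    have hp := A.hp
    have h1 : p * s ^ 2 * |cos t| < onDen s p t := by
      unfold onDen
      rw [sin_sq t, ← sq_abs (cos t)]
      have h2 := abs_nonneg (cos t)
      have h3 := abs_cos_le_one t
      generalize |cos t| = x at *
      have h4 : p * s ^ 2 * x ≤ p * s ^ 2 := by
        simpa using mul_le_mul_of_nonneg_left h3 (by positivity : 0 ≤ p * s ^ 2)
      have h5 : 0 ≤ (p ^ 2 - s ^ 2) * (1 - x ^ 2) := by
        have := A.s_lt_p
        refine mul_nonneg ?_ ?_ <;> nlinarith
      have h6 : p * s ^ 2 < s ^ 2 := by nlinarith [A.p_lt_one, pow_pos hs 2]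
      nlinarith
    have h2 : σ * p * s ^ 2 * cos t / onDen s p t = σ * (p * s ^ 2 * cos t / onDen s p t) := by
      ring
    simp only [onOrbit]
    rw [h2, mul_pow, hσ, one_mul, sq_lt_one_iff_abs_lt_one, abs_div, abs_mul, abs_of_pos hD,
      abs_of_pos (by positivity : 0 < p * s ^ 2), div_lt_one hD]
    exact h1
  clock_continuous := by unfold onClock onRad; fun_prop
  clock_pos t := by
    have := sqrt_pos.2 (onRad_pos A.hs A.s_lt_one A.hp t)
    have := A.hγ
    have := A.he
    unfold onClock; positivity
  clock_bdd := by
    refine ⟨γ * √(s ^ 2 * (2 - s ^ 2) + p ^ 2) / (2 * e), fun t => ?_⟩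
    have := A.hγ
    have := A.he
    have h2 : 0 ≤ s ^ 2 * (2 - s ^ 2) :=
      mul_nonneg (sq_nonneg _) (by nlinarith [A.s_lt_one, A.hs])
    unfold onClock
    gcongr
    unfold onRad
    nlinarith [mul_le_mul_of_nonneg_left (cos_sq_le_one t) h2,
      mul_le_mul_of_nonneg_left (sin_sq_le_one t) (sq_nonneg p)]
  hasDerivAt t := by
    have hD := onDen_pos A.hs A.hp t
    have hR0 := onRad_pos A.hs A.s_lt_one A.hp t
    have hR := sq_sqrt hR0.le
    have hRp := sqrt_pos.2 hR0
    have dD := hasDerivAt_onDen s p t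
    have dR := (hasDerivAt_onRad s p t).sqrt hR0.ne'
    have d1 := (((hasDerivAt_sin t).const_mul (σ * ε * p)).mul dR).div dD hD.ne'
    have d2 := (((hasDerivAt_cos t).pow 2).const_mul (ε * e * s ^ 2)).div dD hD.ne'
    have d3 := ((hasDerivAt_cos t).const_mul (σ * p * s ^ 2)).div dD hD.ne'
    refine (d1.prodMk (d2.prodMk d3)).congr_deriv ?_
    have hγ := A.hγ
    have he := A.he
    have hS := sin_sq t
    have hDe : onDen s p t = s ^ 2 * cos t ^ 2 + p ^ 2 * (1 - cos t ^ 2) := by rw [← hS]; rfl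
    have hRe : √(onRad s p t) ^ 2 = s ^ 2 * (2 - s ^ 2) * cos t ^ 2 + p ^ 2 * (1 - cos t ^ 2) := by
      rw [hR, ← hS]; rfl
    have hδe : δ * e ^ 2 = -(γ * (p ^ 2 - s ^ 2)) := by linear_combination A.p_sq_sub_s_sq
    have hγe : (γ - δ) * e ^ 2 = γ * (1 - s ^ 2) := by
      linear_combination -e ^ 2 * A.b_sq - γ * A.s_sq
    simp only [onOrbit, onClock, eulerField, Prod.smul_mk, smul_eq_mul, Pi.mul_apply, Pi.pow_apply]
    generalize onDen s p t = D at *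
    generalize √(onRad s p t) = R at *
    refine Prod.ext ?_ (Prod.ext ?_ ?_)
    · simp only
      field_simp
      rw [hRe, hS, hDe]
      linear_combination (-2 * s ^ 4 * cos t ^ 2 * σ * ε * p * cos t) * hγe -
        (s ^ 2 * (s ^ 2 * cos t ^ 2 + p ^ 2 * (1 - cos t ^ 2)) * σ * ε * p * cos t) * hκ
    · simp only
      field_simp
      rw [hDe]
      push_cast
      linear_combination (2 * ε * s ^ 2 * p ^ 2 * sin t * cos t) * hσ
    · simp only
      field_simp
      rw [hε, hDe]
      linear_combination (-2 * σ * p * sin t * s ^ 2 * cos t ^ 2) * hδe +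
        (σ * p * sin t * (s ^ 2 * cos t ^ 2 + p ^ 2 * (1 - cos t ^ 2))) * hκ

end

end TwistingSomersault

/-! ### The elliptic integrals along the orbits -/

namespace TwistingSomersault

/-- The integral of an even function of period `π` over `k` periods. -/
theorem integral_even_periodic {g : ℝ → ℝ} (hg : Continuous g) (heven : ∀ x, g (-x) = g x)
    (hper : Function.Periodic g π) (a : ℝ) (k : ℕ) :
    ∫ x in a..a + k * π, g x = 2 * k * ∫ x in (0 : ℝ)..π / 2, g x := by
  have h1 : ∫ x in (-(π / 2))..0, g x = ∫ x in (0 : ℝ)..π / 2, g x := by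
    have e := intervalIntegral.integral_comp_neg (f := g) (a := 0) (b := π / 2)
    rw [neg_zero] at e
    rw [← e]
    simp only [heven]
  have h2 : ∫ x in (0 : ℝ)..π, g x = 2 * ∫ x in (0 : ℝ)..π / 2, g x := by
    have e := hper.intervalIntegral_add_eq 0 (-(π / 2))
    rw [zero_add, show -(π / 2) + π = π / 2 by ring] at e
    rw [e, ← intervalIntegral.integral_add_adjacent_intervals (hg.intervalIntegrable _ 0)
      (hg.intervalIntegrable 0 _), h1]
    ring
  have := hper.intervalIntegral_add_zsmul_eq k a fun _ _ => hg.intervalIntegrable _ _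
  rw [hper.intervalIntegral_add_eq a 0, zero_add, h2] at this
  simp only [zsmul_eq_mul, Int.cast_natCast] at this
  rw [this]
  ring

theorem one_sub_mul_sin_sq_pos {n : ℝ} (hn : n < 1) (t : ℝ) : 0 < 1 - n * sin t ^ 2 := by
  rcases le_total n 0 with h | h
  · nlinarith [mul_nonneg (neg_nonneg.2 h) (sq_nonneg (sin t))]
  · nlinarith [mul_le_mul_of_nonneg_left (sin_sq_le_one t) h]

theorem integral_add_mul_add {f g₁ g₂ : ℝ → ℝ} (hf : Continuous f) (hg₁ : Continuous g₁)
    (hg₂ : Continuous g₂) (x y a c d : ℝ) :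
    ∫ t in x..y, (f t + a * (c * g₁ t + d * g₂ t)) =
      (∫ t in x..y, f t) + a * (c * (∫ t in x..y, g₁ t) + d * ∫ t in x..y, g₂ t) := by
  have h₁ : Continuous fun t => c * g₁ t := continuous_const.mul hg₁
  have h₂ : Continuous fun t => d * g₂ t := continuous_const.mul hg₂
  have h₃ : Continuous fun t => a * (c * g₁ t + d * g₂ t) := continuous_const.mul (h₁.add h₂)
  rw [intervalIntegral.integral_add (hf.intervalIntegrable _ _) (h₃.intervalIntegrable _ _),
    intervalIntegral.integral_const_mul, intervalIntegral.integral_add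
    (h₁.intervalIntegrable _ _) (h₂.intervalIntegrable _ _),
    intervalIntegral.integral_const_mul, intervalIntegral.integral_const_mul]

section

variable {γ δ s e p b : ℝ}

theorem TwistConstants.b_sq_eq (A : TwistConstants γ δ s e p b) : 1 - δ / γ = b ^ 2 := by
  have := A.hγ
  field_simp
  linear_combination -A.b_sq

theorem TwistConstants.b_eq (A : TwistConstants γ δ s e p b) : √(1 - δ / γ) = b := by
  rw [A.b_sq_eq, sqrt_sq A.hb.le]

theorem TwistConstants.e_eq (A : TwistConstants γ δ s e p b) :
    √((1 - s ^ 2) / (1 - δ / γ)) = e := by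
  have := A.hb
  rw [A.b_sq_eq, A.s_sq, mul_div_cancel_right₀ _ (by positivity), sqrt_sq A.he.le]

theorem TwistConstants.sPlus_eq (A : TwistConstants γ δ s e p b) : sPlus (δ / γ) s = p := by
  have hb := A.hb
  have h : δ / γ = 1 - b ^ 2 := by linear_combination -A.b_sq_eq
  rw [sPlus, A.b_sq_eq, h, show (s ^ 2 - (1 - b ^ 2)) / b ^ 2 = p ^ 2 by
    field_simp; linear_combination -A.s_sq - b ^ 2 * A.p_sq, sqrt_sq A.hp.le]

/-- Twisting orbits are determined by the rotor momentum with which they are reached from pure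
somersaulting. -/
theorem exists_twistConstants (hγ : 0 < γ) (hδ : δ < 0) {κ : ℝ} (hκ : 0 < κ) :
    ∃ s e p b, TwistConstants γ δ s e p b ∧ 2 * κ * e = γ * s ^ 2 := by
  have hg : 0 < γ - δ := by linarith
  -- `e` is the positive root of `(γ - δ) e² + 2 κ e = γ`
  set r := √(κ ^ 2 + γ * (γ - δ)) with hr
  have hr2 : r ^ 2 = κ ^ 2 + γ * (γ - δ) := sq_sqrt (by positivity)
  have hrκ : κ < r := by
    rw [hr]; exact lt_sqrt_of_sq_lt (by linarith [mul_pos hγ hg])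
  obtain ⟨e, he⟩ : ∃ e, e = (r - κ) / (γ - δ) := ⟨_, rfl⟩
  have he0 : 0 < e := by rw [he]; exact div_pos (by linarith) hg
  have hre : r = (γ - δ) * e + κ := by rw [he]; field_simp; ring
  have heq : (γ - δ) * e ^ 2 + 2 * κ * e = γ := by
    have h := hr2
    rw [hre] at h
    have : (γ - δ) * ((γ - δ) * e ^ 2 + 2 * κ * e - γ) = 0 := by linear_combination h
    rcases mul_eq_zero.1 this with h | h <;> linarith
  have he1 : e ^ 2 < 1 := by
    have : γ * e ^ 2 < γ * 1 := by nlinarith [mul_pos (neg_pos.2 hδ) (pow_pos he0 2)]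
    exact lt_of_mul_lt_mul_left this hγ.le
  have hs : √(2 * κ * e / γ) ^ 2 = 2 * κ * e / γ := sq_sqrt (by positivity)
  have hb : √((γ - δ) / γ) ^ 2 = (γ - δ) / γ := sq_sqrt (by positivity)
  refine ⟨√(2 * κ * e / γ), e, √(1 - e ^ 2), √((γ - δ) / γ), ⟨hγ, hδ,
    sqrt_pos.2 (by positivity), he0,
    sqrt_pos.2 (by linarith), sqrt_pos.2 (by positivity), ?_, ?_, ?_⟩, ?_⟩
  · rw [hb]; field_simp
  · rw [hs, hb]; field_simp; linear_combination -heq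
  · rw [sq_sqrt (by linarith)]; ring
  · rw [hs]; field_simp

theorem sqrt_offRad (A : TwistConstants γ δ s e p b) (t : ℝ) :
    √(offRad s p t) = (p + s) * √(1 - param₃ (δ / γ) s * sin t ^ 2) := by
  have hp := A.hp
  have hs := A.hs
  rw [param₃, A.sPlus_eq, offRad, show (p + s) ^ 2 - (p - s) ^ 2 * sin t ^ 2 =
    (p + s) ^ 2 * (1 - ((p - s) / (p + s)) ^ 2 * sin t ^ 2) by field_simp,
    sqrt_mul (by positivity), sqrt_sq (by positivity)]

theorem offClock_inv (A : TwistConstants γ δ s e p b) (t : ℝ) :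
    (offClock γ b s p t)⁻¹ =
      2 / (γ * (p + s) * b) * (1 / √(1 - param₃ (δ / γ) s * sin t ^ 2)) := by
  have hg := A.hγ
  have hb := A.hb
  have hp := A.hp
  have hs := A.hs
  have h : 0 < (p + s) * √(1 - param₃ (δ / γ) s * sin t ^ 2) := by
    rw [← sqrt_offRad A]; exact sqrt_pos.2 (offRad_pos hs hp t)
  have h' := (pos_iff_pos_of_mul_pos h).1 (by positivity)
  rw [offClock, sqrt_offRad A]
  field_simp

theorem integral_offClock_inv (A : TwistConstants γ δ s e p b) :
    ∫ x in (0 : ℝ)..π / 2, (offClock γ b s p x)⁻¹ = P₃hat γ (δ / γ) s / 4 := by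
  simp only [offClock_inv A, intervalIntegral.integral_const_mul]
  rw [P₃hat, A.sPlus_eq, A.b_eq, ellipticK]
  ring

/-- Partial fractions, and the parameters `k₃ (1 ∓ s₋) / (1 ± s₋)` of stage 3: the factors of
`1 - u₃²` along the rotor-off orbit. -/
theorem offOrbit_rate (A : TwistConstants γ δ s e p b) {σ : ℝ} (hσ : σ ^ 2 = 1) (t : ℝ) :
    somersaultRate δ 0 (offOrbit s e p b σ t) * (offClock γ b s p t)⁻¹ =
      (offClock γ b s p t)⁻¹ + 2 * s / ((p + s) * b) *
      (1 / ((1 - (p - s) / (p + s) * ((1 - s) / (1 + s)) * sin t ^ 2) *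
          √(1 - param₃ (δ / γ) s * sin t ^ 2)) -
        1 / ((1 - (p - s) / (p + s) * ((1 + s) / (1 - s)) * sin t ^ 2) *
          √(1 - param₃ (δ / γ) s * sin t ^ 2))) := by
  have hg := A.hγ
  have hb := A.hb
  have hp := A.hp
  have hs := A.hs
  have hs1 : 0 < 1 - s := by linarith [A.s_lt_one]
  have hps : 0 < p - s := by linarith [A.s_lt_p]
  have h : 0 < (p + s) * √(1 - param₃ (δ / γ) s * sin t ^ 2) := by
    rw [← sqrt_offRad A]; exact sqrt_pos.2 (offRad_pos hs hp t)
  have h' := (pos_iff_pos_of_mul_pos h).1 (by positivity)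
  have hD := offDen_pos hs hp t
  have hS := sin_sq_le_one t
  have hS0 := sq_nonneg (sin t)
  obtain ⟨X, hX⟩ : ∃ X, X = (p + s) * (1 + s) - (p - s) * (1 - s) * sin t ^ 2 := ⟨_, rfl⟩
  obtain ⟨Y, hY⟩ : ∃ Y, Y = (p + s) * (1 - s) - (p - s) * (1 + s) * sin t ^ 2 := ⟨_, rfl⟩
  have hYp : 0 < Y := by
    rw [hY]
    nlinarith [mul_nonneg (mul_nonneg hps.le (by linarith : 0 ≤ 1 + s)) (sub_nonneg.2 hS),
      mul_pos hs (sub_pos.2 A.p_lt_one)]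
  have hXp : 0 < X := by
    rw [hX]
    nlinarith [mul_nonneg (mul_nonneg hps.le hs1.le) (sub_nonneg.2 hS), mul_pos hs hp]
  have e1 : 1 - (p - s) / (p + s) * ((1 - s) / (1 + s)) * sin t ^ 2 = X / ((p + s) * (1 + s)) := by
    rw [hX]; field_simp
  have e2 : 1 - (p - s) / (p + s) * ((1 + s) / (1 - s)) * sin t ^ 2 = Y / ((p + s) * (1 - s)) := by
    rw [hY]; field_simp
  have e3 : 1 - (offOrbit s e p b σ t).2.2 ^ 2 = X * Y / offDen s p t ^ 2 := by
    simp only [offOrbit]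
    field_simp
    rw [hσ, hX, hY, offDen]
    ring
  have e4 : δ * (offOrbit s e p b σ t).2.1 ^ 2 - 0 * (offOrbit s e p b σ t).2.1 =
      -(4 * γ * (p ^ 2 - s ^ 2) * s ^ 2 * sin t ^ 2 / offDen s p t ^ 2) := by
    simp only [offOrbit]
    field_simp
    linear_combination (4 * s * sin t ^ 2) * A.p_sq_sub_s_sq + (4 * s * sin t ^ 2 * δ * e ^ 2) * hσ
  rw [somersaultRate, e3, e4, e1, e2, offClock_inv A]
  generalize √(1 - param₃ (δ / γ) s * sin t ^ 2) = R at *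
  have e5 : (1 + s) * Y - (1 - s) * X = -(4 * s * (p - s) * sin t ^ 2) := by rw [hX, hY]; ring
  field_simp
  linear_combination (-γ * s * (p + s)) * e5

theorem integral_offOrbit_rate (A : TwistConstants γ δ s e p b) {σ : ℝ} (hσ : σ ^ 2 = 1) :
    ∫ x in (0 : ℝ)..π / 2, somersaultRate δ 0 (offOrbit s e p b σ x) * (offClock γ b s p x)⁻¹ =
      Φ₃ γ (δ / γ) s / 4 := by
  have hU := isEulerOrbit_offOrbit A hσ
  have hg := A.hγ
  have hb := A.hb
  have hp := A.hp
  have hs := A.hs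
  have hs1 : 0 < 1 - s := by linarith [A.s_lt_one]
  have hps : 0 < p - s := by linarith [A.s_lt_p]
  have hR : ∀ t, √(1 - param₃ (δ / γ) s * sin t ^ 2) ≠ 0 := fun t => by
    have h : 0 < (p + s) * √(1 - param₃ (δ / γ) s * sin t ^ 2) := by
      rw [← sqrt_offRad A]; exact sqrt_pos.2 (offRad_pos hs hp t)
    exact ((pos_iff_pos_of_mul_pos h).1 (by positivity)).ne'
  have hn1 : (p - s) / (p + s) * ((1 - s) / (1 + s)) < 1 := by
    rw [div_mul_div_comm, div_lt_one (by positivity)]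
    nlinarith [mul_pos hs hp]
  have hn2 : (p - s) / (p + s) * ((1 + s) / (1 - s)) < 1 := by
    rw [div_mul_div_comm, div_lt_one (by positivity)]
    nlinarith [mul_pos hs (sub_pos.2 A.p_lt_one)]
  have c1 : Continuous fun t => (offClock γ b s p t)⁻¹ :=
    hU.clock_continuous.inv₀ fun t => (hU.clock_pos t).ne'
  have c2 : ∀ n, n < 1 → Continuous fun t : ℝ =>
      1 / ((1 - n * sin t ^ 2) * √(1 - param₃ (δ / γ) s * sin t ^ 2)) := fun n hn' =>
    continuous_const.div (by fun_prop) fun t => mul_ne_zero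
      (one_sub_mul_sin_sq_pos hn' t).ne' (hR t)
  simp only [offOrbit_rate A hσ]
  have i := integral_add_mul_add c1 (c2 _ hn1) (c2 _ hn2) 0 (π / 2) (2 * s / ((p + s) * b)) 1 (-1)
  simp only [one_mul, neg_one_mul, ← sub_eq_add_neg] at i
  rw [i, integral_offClock_inv A, Φ₃, A.sPlus_eq, A.b_eq]
  simp only [ellipticPi]
  ring

theorem sqrt_onRad (A : TwistConstants γ δ s e p b) (t : ℝ) :
    √(onRad s p t) = s * √(2 - s ^ 2) * √(1 - param₂ (δ / γ) s * sin t ^ 2) := by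
  have hb := A.hb
  have hs := A.hs
  have hs2 : 0 < 2 - s ^ 2 := by nlinarith [A.s_lt_one]
  have h : δ / γ = 1 - b ^ 2 := by linear_combination -A.b_sq_eq
  have h2 : s ^ 2 * (2 - s ^ 2) * param₂ (δ / γ) s = s ^ 2 * (2 - s ^ 2) - p ^ 2 := by
    rw [param₂, A.b_sq_eq, h]
    field_simp
    linear_combination A.s_sq + b ^ 2 * A.p_sq
  have h3 : onRad s p t = s ^ 2 * ((2 - s ^ 2) * (1 - param₂ (δ / γ) s * sin t ^ 2)) := by
    rw [onRad, cos_sq']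
    linear_combination sin t ^ 2 * h2
  rw [h3, sqrt_mul (by positivity), sqrt_mul hs2.le, sqrt_sq hs.le]
  ring

theorem onClock_inv (A : TwistConstants γ δ s e p b) (t : ℝ) :
    (onClock γ s e p t)⁻¹ =
      2 * e / (γ * s * √(2 - s ^ 2)) * (1 / √(1 - param₂ (δ / γ) s * sin t ^ 2)) := by
  have hs := A.hs
  have hg := A.hγ
  have he := A.he
  have hs2 : 0 < √(2 - s ^ 2) := sqrt_pos.2 (by nlinarith [A.s_lt_one])
  have h : 0 < s * √(2 - s ^ 2) * √(1 - param₂ (δ / γ) s * sin t ^ 2) := by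
    rw [← sqrt_onRad A]; exact sqrt_pos.2 (onRad_pos hs A.s_lt_one A.hp t)
  have h' := (pos_iff_pos_of_mul_pos h).1 (by positivity)
  rw [onClock, sqrt_onRad A]
  field_simp

theorem integral_onClock_inv (A : TwistConstants γ δ s e p b) :
    ∫ x in (0 : ℝ)..π / 2, (onClock γ s e p x)⁻¹ = T₂hat γ (δ / γ) s := by
  have hs2 : 0 ≤ 2 - s ^ 2 := by nlinarith [A.s_lt_one, A.hs]
  have h : √((1 - s ^ 2) / ((2 - s ^ 2) * (1 - δ / γ))) = e / √(2 - s ^ 2) := by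
    rw [mul_comm, ← div_div, sqrt_div' _ hs2, A.e_eq]
  simp only [onClock_inv A, intervalIntegral.integral_const_mul]
  rw [T₂hat, h, ellipticK]
  ring

/-- The rate of the angle of the second body axis around the angular momentum vector, in scaled
time, as a function of the momentum direction. -/
noncomputable def secondAxisRate (γ : ℝ) (u : ℝ × ℝ × ℝ) : ℝ :=
  1 + γ * u.2.2 ^ 2 / (1 - u.2.1 ^ 2)

/-- Seen along the angular momentum vector, the second and the third body axis include an angle
with tangent `-u₁ / (u₂ u₃)`. Hence the rates of these axes differ by the derivative of an
elementary function, which is given here after a rotation by `π / 4`. -/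
theorem hasDerivAt_axis_angle {κ w t : ℝ} {U : ℝ → ℝ × ℝ × ℝ}
    (hU : HasDerivAt U (w⁻¹ • eulerField γ δ κ (U t)) t)
    (hsph : (U t).1 ^ 2 + (U t).2.1 ^ 2 + (U t).2.2 ^ 2 = 1)
    (h2 : (U t).2.1 ^ 2 < 1) (h3 : (U t).2.2 ^ 2 < 1)
    (hne : (U t).1 + (U t).2.1 * (U t).2.2 ≠ 0) :
    HasDerivAt (fun x => arctan (((U x).1 - (U x).2.1 * (U x).2.2) /
        ((U x).1 + (U x).2.1 * (U x).2.2)))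
      (secondAxisRate γ (U t) * w⁻¹ - somersaultRate δ κ (U t) * w⁻¹) t := by
  have d1 : HasDerivAt (fun x => (U x).1) _ t := hU.fst
  have d2 : HasDerivAt (fun x => (U x).2.1) _ t := hU.snd.fst
  have d3 : HasDerivAt (fun x => (U x).2.2) _ t := hU.snd.snd
  simp only [eulerField, Prod.smul_mk, smul_eq_mul] at d1 d2 d3
  refine ((d1.sub (d2.mul d3)).div (d1.add (d2.mul d3)) hne).arctan.congr_deriv ?_
  simp only [Pi.sub_apply, Pi.add_apply, Pi.mul_apply, Pi.div_apply, somersaultRate, secondAxisRate]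
  generalize (U t).1 = x at *
  generalize (U t).2.1 = y at *
  generalize (U t).2.2 = z at *
  have g2 : 1 - y ^ 2 ≠ 0 := by linarith
  have g3 : 1 - z ^ 2 ≠ 0 := by linarith
  have hx : x ^ 2 = 1 - y ^ 2 - z ^ 2 := by linear_combination hsph
  have hq : 1 + ((x - y * z) / (x + y * z)) ^ 2 =
      2 * ((1 - y ^ 2) * (1 - z ^ 2)) / (x + y * z) ^ 2 := by
    field_simp
    linear_combination 2 * hx
  rw [hq]
  generalize w⁻¹ = v
  field_simp
  linear_combination (-2 * v * (-(z ^ 2 * γ) + y * (y * δ - κ))) * hx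

/-- Partial fractions, and the parameters `n₊`, `n₋` of stage 2: the factors of `1 - u₂²` along the
rotor-on orbit. -/
theorem onOrbit_secondAxisRate (A : TwistConstants γ δ s e p b) (t : ℝ) :
    secondAxisRate γ (onOrbit s e p 1 1 t) * (onClock γ s e p t)⁻¹ =
      (onClock γ s e p t)⁻¹ + 1 / (s * √(2 - s ^ 2)) *
      ((e - 1) * (1 / ((1 - (1 - 1 / s ^ 2 + 1 / s ^ 2 * e) * sin t ^ 2) *
          √(1 - param₂ (δ / γ) s * sin t ^ 2))) +
       (e + 1) * (1 / ((1 - (1 - 1 / s ^ 2 - 1 / s ^ 2 * e) * sin t ^ 2) *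
          √(1 - param₂ (δ / γ) s * sin t ^ 2)))) := by
  have hs := A.hs
  have hg := A.hγ
  have he := A.he
  have hp := A.hp
  have he1 : 0 < 1 - e := by linarith [A.e_lt_one]
  have hs2 : 0 < √(2 - s ^ 2) := sqrt_pos.2 (by nlinarith [A.s_lt_one])
  have h : 0 < s * √(2 - s ^ 2) * √(1 - param₂ (δ / γ) s * sin t ^ 2) := by
    rw [← sqrt_onRad A]; exact sqrt_pos.2 (onRad_pos hs A.s_lt_one A.hp t)
  have h' := (pos_iff_pos_of_mul_pos h).1 (by positivity)
  have hD := onDen_pos hs hp t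
  have hC := cos_sq' t
  have hc := sin_sq_add_cos_sq t
  obtain ⟨X, hX⟩ : ∃ X, X = s ^ 2 * cos t ^ 2 + (1 - e) * sin t ^ 2 := ⟨_, rfl⟩
  obtain ⟨Y, hY⟩ : ∃ Y, Y = s ^ 2 * cos t ^ 2 + (1 + e) * sin t ^ 2 := ⟨_, rfl⟩
  have hXp : 0 < X := by
    rw [hX]
    have := mul_nonneg (sq_nonneg s) (sq_nonneg (cos t))
    have := mul_nonneg he1.le (sq_nonneg (sin t))
    rcases eq_or_ne (sin t) 0 with h0 | h0
    · rw [h0] at hc ⊢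
      have : cos t ^ 2 = 1 := by linarith
      rw [this]; positivity
    · positivity
  have hYp : 0 < Y := by
    have : Y = X + 2 * e * sin t ^ 2 := by rw [hX, hY]; ring
    rw [this]; positivity
  have e1 : 1 - (1 - 1 / s ^ 2 + 1 / s ^ 2 * e) * sin t ^ 2 = X / s ^ 2 := by
    rw [hX, hC]; field_simp; ring
  have e2 : 1 - (1 - 1 / s ^ 2 - 1 / s ^ 2 * e) * sin t ^ 2 = Y / s ^ 2 := by
    rw [hY, hC]; field_simp; ring
  have hpe : p ^ 2 = (1 - e) * (1 + e) := by linear_combination A.p_sq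
  have e3 : 1 - (onOrbit s e p 1 1 t).2.1 ^ 2 = p ^ 2 * X * Y / onDen s p t ^ 2 := by
    simp only [onOrbit]
    field_simp
    rw [hX, hY, onDen, hpe, sin_sq t]
    ring
  have e4 : γ * (onOrbit s e p 1 1 t).2.2 ^ 2 =
      γ * p ^ 2 * s ^ 4 * cos t ^ 2 / onDen s p t ^ 2 := by
    simp only [onOrbit]
    field_simp
  have e5 : (e - 1) * Y + (e + 1) * X = 2 * e * s ^ 2 * cos t ^ 2 := by rw [hX, hY]; ring
  rw [secondAxisRate, e3, e4, e1, e2, onClock_inv A]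
  generalize √(1 - param₂ (δ / γ) s * sin t ^ 2) = R at *
  generalize √(2 - s ^ 2) = r at *
  field_simp
  linear_combination (-γ * s ^ 2) * e5

theorem onOrbit_one_one_mem (A : TwistConstants γ δ s e p b) (t : ℝ) :
    (onOrbit s e p 1 1 t).2.1 ^ 2 < 1 := by
  have hD := onDen_pos A.hs A.hp t
  have hs := A.hs
  have he := A.he
  have hp := A.hp
  simp only [onOrbit, one_mul]
  rw [sq_lt_one_iff₀ (by positivity), div_lt_one hD]
  unfold onDen
  rcases eq_or_ne (sin t) 0 with h0 | h0
  · have hc := sin_sq_add_cos_sq t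
    rw [h0] at hc ⊢
    have : cos t ^ 2 = 1 := by linarith
    rw [this]
    nlinarith [A.e_lt_one, pow_pos hs 2]
  · have : 0 < p ^ 2 * sin t ^ 2 := by positivity
    have : 0 ≤ s ^ 2 * cos t ^ 2 := by positivity
    nlinarith [mul_nonneg this (sub_nonneg.2 A.e_lt_one.le)]

theorem somersaultRate_onOrbit {σ ε κ : ℝ} (hσ : σ ^ 2 = 1)
    (hε : ε ^ 2 = 1) (t : ℝ) :
    somersaultRate δ (ε * κ) (onOrbit s e p σ ε t) =
      somersaultRate δ κ (onOrbit s e p 1 1 t) := by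
  have h1 : (onOrbit s e p σ ε t).2.1 = ε * (onOrbit s e p 1 1 t).2.1 := by
    simp only [onOrbit]; ring
  have h2 : (onOrbit s e p σ ε t).2.2 = σ * (onOrbit s e p 1 1 t).2.2 := by
    simp only [onOrbit]; ring
  have h3 : ∀ y : ℝ, ε * κ * (ε * y) = κ * y := fun y => by
    linear_combination κ * y * hε
  rw [somersaultRate, somersaultRate, h1, h2, mul_pow, mul_pow, hσ, hε, one_mul, one_mul, h3]

theorem integral_onOrbit_rate (A : TwistConstants γ δ s e p b) {σ ε κ : ℝ} (hσ : σ ^ 2 = 1)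
    (hε : ε ^ 2 = 1) (hκ : 2 * κ * e = γ * s ^ 2) :
    ∫ x in (0 : ℝ)..π / 2,
      somersaultRate δ (ε * κ) (onOrbit s e p σ ε x) * (onClock γ s e p x)⁻¹ =
      φ₂ γ (δ / γ) s := by
  simp only [somersaultRate_onOrbit hσ hε]
  have hU := isEulerOrbit_onOrbit A (one_pow 2) (one_pow 2) hκ
  rw [one_mul] at hU
  have hs := A.hs
  have hg := A.hγ
  have he := A.he
  have hp := A.hp
  have hb := A.hb
  have hs2 : 0 < √(2 - s ^ 2) := sqrt_pos.2 (by nlinarith [A.s_lt_one])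
  have hR : ∀ t, √(1 - param₂ (δ / γ) s * sin t ^ 2) ≠ 0 := fun t => by
    have h : 0 < s * √(2 - s ^ 2) * √(1 - param₂ (δ / γ) s * sin t ^ 2) := by
      rw [← sqrt_onRad A]; exact sqrt_pos.2 (onRad_pos hs A.s_lt_one A.hp t)
    exact ((pos_iff_pos_of_mul_pos h).1 (by positivity)).ne'
  have hi : 0 < 1 / s ^ 2 := by positivity
  have hn1 : 1 - 1 / s ^ 2 + 1 / s ^ 2 * e < 1 := by nlinarith [A.e_lt_one]
  have hn2 : 1 - 1 / s ^ 2 - 1 / s ^ 2 * e < 1 := by nlinarith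
  have c1 : Continuous fun t => (onClock γ s e p t)⁻¹ :=
    hU.clock_continuous.inv₀ fun t => (hU.clock_pos t).ne'
  have c2 : ∀ n, n < 1 → Continuous fun t : ℝ =>
      1 / ((1 - n * sin t ^ 2) * √(1 - param₂ (δ / γ) s * sin t ^ 2)) := fun n hn' =>
    continuous_const.div (by fun_prop) fun t => mul_ne_zero
      (one_sub_mul_sin_sq_pos hn' t).ne' (hR t)
  have c3 : Continuous fun t => somersaultRate δ κ (onOrbit s e p 1 1 t) * (onClock γ s e p t)⁻¹ :=
    hU.continuous_somersaultRate.mul c1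
  have c4 : Continuous fun t => secondAxisRate γ (onOrbit s e p 1 1 t) * (onClock γ s e p t)⁻¹ := by
    simp only [onOrbit_secondAxisRate A]
    exact c1.add (continuous_const.mul ((continuous_const.mul (c2 _ hn1)).add
      (continuous_const.mul (c2 _ hn2))))
  have i4 : ∫ x in (0 : ℝ)..π / 2,
      secondAxisRate γ (onOrbit s e p 1 1 x) * (onClock γ s e p x)⁻¹ = φ₂ γ (δ / γ) s + π / 2 := by
    simp only [onOrbit_secondAxisRate A]
    rw [integral_add_mul_add c1 (c2 _ hn1) (c2 _ hn2), integral_onClock_inv A, φ₂, A.e_eq]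
    have q1 : √((1 - s ^ 2) * (1 - δ / γ)) = e * b ^ 2 := by
      rw [A.b_sq_eq, A.s_sq, show e ^ 2 * b ^ 2 * b ^ 2 = (e * b ^ 2) ^ 2 by ring,
        sqrt_sq (by positivity)]
    have q2 : √((1 - s ^ 2) * (2 - s ^ 2) * (1 - δ / γ)) = e * b ^ 2 * √(2 - s ^ 2) := by
      rw [show (1 - s ^ 2) * (2 - s ^ 2) * (1 - δ / γ) = (1 - s ^ 2) * (1 - δ / γ) * (2 - s ^ 2) by
        ring, sqrt_mul (mul_nonneg (by rw [A.s_sq]; positivity) (by rw [A.b_sq_eq]; positivity)), q1]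
    rw [q1, q2, ← ellipticPi, ← ellipticPi]
    generalize ellipticPi (1 - 1 / s ^ 2 + 1 / s ^ 2 * e) _ = x
    generalize ellipticPi (1 - 1 / s ^ 2 - 1 / s ^ 2 * e) _ = y
    rw [A.s_sq]
    field_simp
    ring
  have c5 : Continuous fun t => secondAxisRate γ (onOrbit s e p 1 1 t) * (onClock γ s e p t)⁻¹ -
      somersaultRate δ κ (onOrbit s e p 1 1 t) * (onClock γ s e p t)⁻¹ := c4.sub c3
  -- the angle between the axes turns from `-π / 4` to `π / 4` in the rotated form
  have i5 := intervalIntegral.integral_eq_sub_of_hasDerivAt (a := 0) (b := π / 2) (fun t ht => by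
    rw [uIcc_of_le (by positivity)] at ht
    have hD := onDen_pos hs hp t
    have hRt := sqrt_pos.2 (onRad_pos hs A.s_lt_one hp t)
    have hc : 0 ≤ cos t := cos_nonneg_of_mem_Icc ⟨by linarith [ht.1, pi_pos], ht.2⟩
    have hsn : 0 ≤ sin t := sin_nonneg_of_mem_Icc ⟨ht.1, by linarith [ht.2, pi_pos]⟩
    refine hasDerivAt_axis_angle (hU.hasDerivAt t) (hU.sphere t) (onOrbit_one_one_mem A t)
      (hU.pole t) ?_
    simp only [onOrbit, one_mul]
    refine ne_of_gt ?_
    rcases hsn.eq_or_lt with h0 | h0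
    · have hcc := sin_sq_add_cos_sq t
      have : cos t ≠ 0 := fun h => by rw [h, ← h0] at hcc; norm_num at hcc
      have : 0 < cos t := lt_of_le_of_ne hc this.symm
      positivity
    · positivity) (c5.intervalIntegrable _ _)
  rw [intervalIntegral.integral_sub (c4.intervalIntegrable _ _) (c3.intervalIntegrable _ _), i4]
    at i5
  have hD1 := onDen_pos hs hp (π / 2)
  have hRt := sqrt_pos.2 (onRad_pos hs A.s_lt_one hp (π / 2))
  have hD0 := onDen_pos hs hp 0
  have v1 : (onOrbit s e p 1 1 (π / 2)).1 ≠ 0 := by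
    simp only [onOrbit, one_mul, sin_pi_div_two]
    positivity
  have v2 : (onOrbit s e p 1 1 0).2.1 * (onOrbit s e p 1 1 0).2.2 ≠ 0 := by
    simp only [onOrbit, one_mul, cos_zero]
    positivity
  have v3 : (onOrbit s e p 1 1 (π / 2)).2.1 = 0 := by simp [onOrbit]
  have v4 : (onOrbit s e p 1 1 0).1 = 0 := by simp [onOrbit]
  rw [v3, v4, zero_mul, sub_zero, add_zero, zero_sub, zero_add, div_self v1, neg_div, div_self v2,
    arctan_neg, arctan_one] at i5
  linarith

end

end TwistingSomersault

/-! ### The stages of a dive -/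

namespace TwistingSomersault

section

variable {I₁ I₂ I₃ l h γ δ κ : ℝ} {q : Motion} {U : ℝ → ℝ × ℝ × ℝ} {w α : ℝ → ℝ} {a b c : ℝ}

theorem Follows.abs_theta_eq (F : Follows q (l / I₁) U w α a b) {t : ℝ} (ht : t ∈ Icc a b)
    (hθ : |q.theta t| < π / 2) : |q.theta t| = arcsin |(U (α t)).2.2| := by
  have h := abs_lt.1 hθ
  rw [← F.eq t ht]
  simp only [bodyDirection]
  rcases le_total 0 (q.theta t) with h0 | h0
  · rw [abs_of_nonneg h0, abs_of_nonneg (sin_nonneg_of_nonneg_of_le_pi h0 (by linarith)),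
      arcsin_sin (by linarith) (by linarith)]
  · rw [abs_of_nonpos h0, abs_of_nonpos (sin_nonpos_of_nonpos_of_neg_pi_le h0 (by linarith)),
      ← sin_neg, arcsin_sin (by linarith) (by linarith)]

/-- A criterion for the twist angle at the end of a stage. Let `β` be an angle given as a function
of the position along the orbit, which is the twist angle at the beginning. If the directions of
`β` and of the twist always include an acute angle and are parallel at the end, then `β` is the
twist angle at the end. -/
theorem Follows.psi_eq (F : Follows q (l / I₁) U w α a b)
    (H : SolvesMotion I₁ I₂ I₃ l h q (Icc a b)) (hab : a ≤ b)
    (hθ : ∀ t ∈ Icc a b, |q.theta t| < π / 2) {β : ℝ → ℝ} (hβ : Continuous β)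
    (hpos : ∀ x ∈ Icc (α a) (α b), 0 < (U x).1 * cos (β x) - (U x).2.1 * sin (β x))
    (ha : q.psi a = β (α a))
    (hb : (U (α b)).2.1 * cos (β (α b)) + (U (α b)).1 * sin (β (α b)) = 0) :
    q.psi b = β (α b) := by
  have hcos : ∀ t ∈ Icc a b, 0 < cos (q.theta t) := fun t ht =>
    cos_pos_of_mem_Ioo (abs_lt.1 (hθ t ht))
  have hα : Continuous α := continuous_iff_continuousAt.2 fun t => (F.hasDerivAt t).continuousAt
  refine angle_eq_of_cos_sub_pos (β := fun t => β (α t)) H.continuousOn_psi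
    (hβ.comp hα).continuousOn (fun t ht => ?_) (left_mem_Icc.2 hab) ha (right_mem_Icc.2 hab) ?_
  · have := hpos (α t) ⟨F.strictMono.monotone ht.1, F.strictMono.monotone ht.2⟩
    rw [← F.eq t ht] at this
    simp only [bodyDirection] at this
    refine (pos_iff_pos_of_mul_pos (a := cos (q.theta t)) ?_).1 (hcos t ht)
    rw [cos_sub]
    linarith
  · rw [← F.eq b (right_mem_Icc.2 hab)] at hb
    simp only [bodyDirection] at hb
    refine (mul_eq_zero.1 (?_ : cos (q.theta b) * _ = 0)).resolve_left
      (hcos b (right_mem_Icc.2 hab)).ne'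
    rw [sin_sub]
    linarith

/-- Pure somersaulting with the rotor off is an equilibrium. -/
theorem isEulerOrbit_const {x : ℝ} (hx : x ^ 2 = 1) :
    IsEulerOrbit γ δ 0 (fun _ => (x, 0, 0)) (fun _ => 1) where
  hasDerivAt t := by
    refine (hasDerivAt_const t _).congr_deriv ?_
    simp [eulerField, Prod.ext_iff]
  sphere t := by simp [hx]
  pole t := by simp
  clock_continuous := continuous_const
  clock_pos t := one_pos
  clock_bdd := ⟨1, fun _ => le_rfl⟩

theorem pure_somersault_stage (h₁ : 0 < I₁) (h₂ : I₂ ≠ 0) (h₃ : I₃ ≠ 0)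
    (hl : 0 < l) (hδ : δ = I₁ / I₂ - 1) (hγ : γ = I₁ / I₃ - 1)
    (H : SolvesMotion I₁ I₂ I₃ l 0 q (Icc a b)) (hab : a ≤ b) {x : ℝ} (hx : x ^ 2 = 1)
    (hθ : |q.theta a| < π / 2) (ha : bodyDirection (q.theta a) (q.psi a) = (x, 0, 0)) :
    bodyDirection (q.theta b) (q.psi b) = (x, 0, 0) ∧ |q.theta b| < π / 2 ∧ q.psi b = q.psi a ∧
      q.phi b - q.phi a = l / I₁ * (b - a) := by
  have hU := isEulerOrbit_const (γ := γ) (δ := δ) hx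
  have hκ : (0 : ℝ) = 0 / l * (I₁ / I₂) := by simp
  obtain ⟨α, -, F⟩ := H.follows h₁ h₂ h₃ hl hδ hγ hκ hU (left_mem_Icc.2 hab) (t₀ := 0) ha
  have hθ' := F.abs_theta_lt hU H (left_mem_Icc.2 hab) hθ
  have hca : 0 < cos (q.theta a) := cos_pos_of_mem_Ioo (abs_lt.1 hθ)
  simp only [bodyDirection, Prod.mk.injEq, neg_eq_zero] at ha
  obtain ⟨e1, e2, -⟩ := ha
  have e2' : sin (q.psi a) = 0 := (mul_eq_zero.1 e2).resolve_left hca.ne'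
  have e1' : 0 < x * cos (q.psi a) := by
    have h0 : cos (q.psi a) ≠ 0 := fun h0 => by
      have := sin_sq_add_cos_sq (q.psi a)
      rw [h0, e2'] at this
      norm_num at this
    rw [← e1]
    have : 0 < cos (q.psi a) ^ 2 := by positivity
    nlinarith
  refine ⟨F.eq b (right_mem_Icc.2 hab), hθ' b (right_mem_Icc.2 hab), ?_, ?_⟩
  · refine F.psi_eq H hab hθ' (β := fun _ => q.psi a) continuous_const (fun y _ => ?_) rfl ?_
    · simpa using e1'
    · simp [e2']
  · rw [F.duration hU hab, F.somersault hU h₁.ne' h₂ hl.ne' hδ hκ H hab]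
    simp [somersaultRate]

/-- Conservation of energy. -/
theorem energy_eq (h₁ : I₁ ≠ 0) (h₂ : I₂ ≠ 0) (h₃ : I₃ ≠ 0)
    (hl : l ≠ 0) (hδ : δ = I₁ / I₂ - 1) (hγ : γ = I₁ / I₃ - 1) (hκ : κ = h / l * (I₁ / I₂))
    (H : SolvesMotion I₁ I₂ I₃ l h q (Icc a b)) (hab : a ≤ b) {u v : ℝ × ℝ × ℝ}
    (hu : bodyDirection (q.theta a) (q.psi a) = u) (hv : bodyDirection (q.theta b) (q.psi b) = v) :
    γ * u.2.2 ^ 2 + δ * u.2.1 ^ 2 - 2 * κ * u.2.1 =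
      γ * v.2.2 ^ 2 + δ * v.2.1 ^ 2 - 2 * κ * v.2.1 := by
  subst hu hv
  have hd : ∀ t ∈ Icc a b, HasDerivWithinAt (fun t =>
      γ * (bodyDirection (q.theta t) (q.psi t)).2.2 ^ 2 +
      δ * (bodyDirection (q.theta t) (q.psi t)).2.1 ^ 2 -
      2 * κ * (bodyDirection (q.theta t) (q.psi t)).2.1) 0 (Icc a b) t := by
    intro t ht
    have hu := H.hasDerivWithinAt_bodyDirection h₁ h₂ h₃ hl hδ hγ hκ ht
    have h2 : HasDerivWithinAt (fun t => (bodyDirection (q.theta t) (q.psi t)).2.1) _ _ t :=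
      hu.snd.fst
    have h3 : HasDerivWithinAt (fun t => (bodyDirection (q.theta t) (q.psi t)).2.2) _ _ t :=
      hu.snd.snd
    refine ((((h3.pow 2).const_mul γ).add ((h2.pow 2).const_mul δ)).sub
      (h2.const_mul (2 * κ))).congr_deriv ?_
    simp only [eulerField, Prod.smul_mk, smul_eq_mul]
    push_cast
    ring
  exact (constant_of_has_deriv_right_zero (fun τ hτ => (hd τ hτ).continuousWithinAt)
    (fun τ hτ => (hd τ (Ico_subset_Icc_self hτ)).mono_of_mem_nhdsWithin
      (Icc_mem_nhdsGE_of_mem hτ)) b (right_mem_Icc.2 hab)).symm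

end

section

variable {γ δ s e p b : ℝ}

theorem onOrbit_zero (A : TwistConstants γ δ s e p b) (σ ε : ℝ) :
    onOrbit s e p σ ε 0 = (0, ε * e, σ * p) := by
  have := A.hs
  simp only [onOrbit, onDen, sin_zero, cos_zero]
  refine Prod.ext ?_ (Prod.ext ?_ ?_) <;> simp only <;> field_simp <;> ring

theorem onOrbit_of_cos_eq_zero (A : TwistConstants γ δ s e p b) (σ ε : ℝ) {t : ℝ}
    (ht : cos t = 0) : onOrbit s e p σ ε t = (σ * ε * sin t, 0, 0) := by
  have hp := A.hp
  have h1 : sin t ^ 2 = 1 := by rw [sin_sq, ht]; ring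
  simp only [onOrbit, onDen, onRad, ht, h1]
  refine Prod.ext ?_ (Prod.ext ?_ ?_)
  · simp only
    rw [show s ^ 2 * (2 - s ^ 2) * 0 ^ 2 + p ^ 2 * 1 = p ^ 2 by ring, sqrt_sq hp.le]
    field_simp
    ring
  · simp
  · simp

theorem offOrbit_of_cos_eq_zero (A : TwistConstants γ δ s e p b) (σ : ℝ) {t : ℝ}
    (ht : cos t = 0) : offOrbit s e p b σ t = (0, -(σ * e * sin t), σ * p) := by
  have hs := A.hs
  have h1 : sin t ^ 2 = 1 := by rw [sin_sq, ht]; ring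
  have hD : offDen s p t = 2 * s := by rw [offDen, h1]; ring
  simp only [offOrbit, hD, ht, h1]
  refine Prod.ext ?_ (Prod.ext ?_ ?_)
  · simp
  · simp only
    field_simp
  · simp only
    field_simp
    ring

theorem abs_onOrbit_le (A : TwistConstants γ δ s e p b) {σ : ℝ} (hσ : σ ^ 2 = 1) (ε t : ℝ) :
    |(onOrbit s e p σ ε t).2.2| ≤ p * |cos t| := by
  have hD := onDen_pos A.hs A.hp t
  have hσ' : |σ| = 1 := by rwa [← sq_eq_sq₀ (abs_nonneg _) zero_le_one, one_pow, sq_abs]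
  have hp := A.hp
  simp only [onOrbit]
  rw [abs_div, abs_mul, abs_mul, abs_mul, hσ', abs_of_pos hD, abs_of_pos hp, one_mul,
    abs_of_nonneg (sq_nonneg s), div_le_iff₀ hD]
  have h1 : s ^ 2 ≤ onDen s p t := by
    have h0 : 0 ≤ (p ^ 2 - s ^ 2) * sin t ^ 2 :=
      mul_nonneg (by nlinarith [A.s_lt_p, A.hs]) (sq_nonneg _)
    rw [onDen, cos_sq']
    linarith
  nlinarith [mul_le_mul_of_nonneg_left h1 (mul_nonneg hp.le (abs_nonneg (cos t)))]

theorem abs_offOrbit (A : TwistConstants γ δ s e p b) {σ : ℝ} (hσ : σ ^ 2 = 1) (t : ℝ) :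
    |(offOrbit s e p b σ t).2.2| = s * (p + s + (p - s) * sin t ^ 2) / offDen s p t := by
  have hD := offDen_pos A.hs A.hp t
  have hσ' : |σ| = 1 := by rwa [← sq_eq_sq₀ (abs_nonneg _) zero_le_one, one_pow, sq_abs]
  have hs := A.hs
  have hp := A.hp
  have hps : 0 < p - s := sub_pos.2 A.s_lt_p
  simp only [offOrbit]
  rw [mul_assoc, mul_div_assoc, abs_mul, hσ', one_mul, abs_of_nonneg (by positivity)]

theorem isLeast_offOrbit (A : TwistConstants γ δ s e p b) {σ : ℝ} (hσ : σ ^ 2 = 1) :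
    IsLeast (range fun t => arcsin |(offOrbit s e p b σ t).2.2|) (arcsin s) := by
  have hs := A.hs
  have hp := A.hp
  refine ⟨⟨0, ?_⟩, ?_⟩
  · simp only [abs_offOrbit A hσ, offDen, sin_zero]
    congr 1
    rw [zero_pow two_ne_zero, mul_zero, add_zero, sub_zero,
      mul_div_cancel_right₀ _ (add_pos hp hs).ne']
  · rintro _ ⟨t, rfl⟩
    refine monotone_arcsin ?_
    rw [abs_offOrbit A hσ, le_div_iff₀ (offDen_pos hs hp t), offDen]
    have : 0 ≤ s * ((p - s) * sin t ^ 2) :=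
      mul_nonneg hs.le (mul_nonneg (sub_nonneg.2 A.s_lt_p.le) (sq_nonneg _))
    linarith

theorem isGreatest_offOrbit (A : TwistConstants γ δ s e p b) {σ : ℝ} (hσ : σ ^ 2 = 1) :
    IsGreatest (range fun t => arcsin |(offOrbit s e p b σ t).2.2|) (arcsin p) := by
  have hs := A.hs
  have hp := A.hp
  refine ⟨⟨π / 2, ?_⟩, ?_⟩
  · simp only [abs_offOrbit A hσ, offDen, sin_pi_div_two]
    congr 1
    have : p + s - (p - s) * 1 ^ 2 = 2 * s := by ring
    rw [this]
    field_simp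
    ring
  · rintro _ ⟨t, rfl⟩
    refine monotone_arcsin ?_
    rw [abs_offOrbit A hσ, div_le_iff₀ (offDen_pos hs hp t), offDen]
    have : 0 ≤ (p + s) * (p - s) * (1 - sin t ^ 2) :=
      mul_nonneg (mul_nonneg (by positivity) (sub_nonneg.2 A.s_lt_p.le))
        (sub_nonneg.2 (sin_sq_le_one t))
    linarith

/-- Two parameters of the rotor-off orbit give the same point only if they differ by a multiple
of `2π`. -/
theorem offOrbit_injective (A : TwistConstants γ δ s e p b) {σ : ℝ} (hσ : σ ^ 2 = 1) {x y : ℝ}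
    (h : offOrbit s e p b σ x = offOrbit s e p b σ y) : ∃ k : ℤ, x = y + k * (2 * π) := by
  have hs := A.hs
  have hp := A.hp
  have he := A.he
  have hb := A.hb
  have hps : 0 < p - s := sub_pos.2 A.s_lt_p
  have hDx := offDen_pos hs hp x
  have hDy := offDen_pos hs hp y
  have hσ0 : σ ≠ 0 := fun h => by rw [h] at hσ; norm_num at hσ
  have h3 : |(offOrbit s e p b σ x).2.2| = |(offOrbit s e p b σ y).2.2| := by rw [h]
  have hS : sin x ^ 2 = sin y ^ 2 := by
    rw [abs_offOrbit A hσ, abs_offOrbit A hσ, div_eq_div_iff hDx.ne' hDy.ne'] at h3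
    unfold offDen at h3
    have : 2 * s * (p + s) * (p - s) * (sin x ^ 2 - sin y ^ 2) = 0 := by linear_combination h3
    have h4 : 2 * s * (p + s) * (p - s) ≠ 0 := by positivity
    linarith [(mul_eq_zero.1 this).resolve_left h4]
  have hR : offRad s p x = offRad s p y := by rw [offRad, offRad, hS]
  have hD : offDen s p x = offDen s p y := by rw [offDen, offDen, hS]
  have hRy := sqrt_pos.2 (offRad_pos hs hp y)
  have h1 : (offOrbit s e p b σ x).1 = (offOrbit s e p b σ y).1 := by rw [h]
  have h2 : (offOrbit s e p b σ x).2.1 = (offOrbit s e p b σ y).2.1 := by rw [h]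
  simp only [offOrbit] at h1 h2
  rw [hR, hD] at h1
  rw [hD] at h2
  have hc : cos x = cos y := by
    field_simp at h1
    exact h1
  have hsn : sin x = sin y := by
    field_simp at h2
    linarith
  have hcos : cos (x - y) = 1 := by
    rw [cos_sub, hc, hsn]
    linear_combination sin_sq_add_cos_sq y
  obtain ⟨k, hk⟩ := (cos_eq_one_iff _).1 hcos
  exact ⟨k, by linarith⟩

end

section

variable {I₁ I₂ I₃ l h γ δ κ : ℝ} {q : Motion} {α : ℝ → ℝ} {a b s e p β σ ε : ℝ}

/-- Along the rotor-on orbit, the twist changes by a right angle between pure somersaulting and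
maximal tilt. -/
theorem psi_eq_of_follows_onOrbit (A : TwistConstants γ δ s e p β) (hσ : σ ^ 2 = 1)
    (hε : ε ^ 2 = 1) (F : Follows q (l / I₁) (onOrbit s e p σ ε) (onClock γ s e p) α a b)
    (H : SolvesMotion I₁ I₂ I₃ l h q (Icc a b)) (hab : a ≤ b)
    (hθ : ∀ t ∈ Icc a b, |q.theta t| < π / 2)
    {ψ₀ : ℝ} (hc : cos ψ₀ = 0) (hs : sin ψ₀ = -ε) (hαa : -(π / 2) ≤ α a) (hαb : α b ≤ π / 2)
    (ha : q.psi a = ψ₀ + σ * α a) (hb : sin (α b) * cos (α b) = 0) :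
    q.psi b = ψ₀ + σ * α b := by
  have hσ' : σ = 1 ∨ σ = -1 := by simpa using hσ
  have e1 : ∀ x, cos (ψ₀ + σ * x) = ε * σ * sin x := fun x => by
    rw [cos_add, hc, hs]; rcases hσ' with rfl | rfl <;> simp
  have e2 : ∀ x, sin (ψ₀ + σ * x) = -(ε * cos x) := fun x => by
    rw [sin_add, hc, hs]; rcases hσ' with rfl | rfl <;> simp
  refine F.psi_eq H hab hθ (β := fun x => ψ₀ + σ * x) (by fun_prop) (fun x hx => ?_) ha ?_
  · have hD := onDen_pos A.hs A.hp x
    have hRt := sqrt_pos.2 (onRad_pos A.hs A.s_lt_one A.hp x)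
    have hcx : 0 ≤ cos x := cos_nonneg_of_mem_Icc ⟨hαa.trans hx.1, hx.2.trans hαb⟩
    have : (onOrbit s e p σ ε x).1 * cos (ψ₀ + σ * x) -
        (onOrbit s e p σ ε x).2.1 * sin (ψ₀ + σ * x) =
        (p * √(onRad s p x) * sin x ^ 2 + e * s ^ 2 * cos x ^ 3) / onDen s p x := by
      rw [e1, e2]
      simp only [onOrbit]
      field_simp
      rw [hσ, hε]
      ring
    rw [this]
    have := A.hs
    have := A.hp
    have := A.he
    refine div_pos ?_ hD
    rcases eq_or_ne (sin x) 0 with h0 | h0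
    · have hcc := sin_sq_add_cos_sq x
      have h1 : cos x ≠ 0 := fun h1 => by rw [h0, h1] at hcc; norm_num at hcc
      have : 0 < cos x := lt_of_le_of_ne hcx h1.symm
      positivity
    · positivity
  · rw [e1, e2]
    simp only [onOrbit]
    linear_combination (ε ^ 2 * σ * (e * s ^ 2 * cos (α b) - p * √(onRad s p (α b))) /
      onDen s p (α b)) * hb

/-- The rotor-off stage: from maximal tilt to maximal tilt. -/
theorem psi_eq_of_follows_offOrbit (A : TwistConstants γ δ s e p β) (hσ : σ ^ 2 = 1)
    (F : Follows q (l / I₁) (offOrbit s e p β σ) (offClock γ β s p) α a b)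
    (H : SolvesMotion I₁ I₂ I₃ l h q (Icc a b)) (hab : a ≤ b)
    (hθ : ∀ t ∈ Icc a b, |q.theta t| < π / 2)
    (ha : q.psi a = σ * α a) (hb : cos (α b) = 0) : q.psi b = σ * α b := by
  have hσ' : σ = 1 ∨ σ = -1 := by simpa using hσ
  have e1 : ∀ x, cos (σ * x) = cos x := fun x => by rcases hσ' with rfl | rfl <;> simp
  have e2 : ∀ x, sin (σ * x) = σ * sin x := fun x => by rcases hσ' with rfl | rfl <;> simp
  refine F.psi_eq H hab hθ (β := fun x => σ * x) (by fun_prop) (fun x hx => ?_) ha ?_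
  · have hD := offDen_pos A.hs A.hp x
    have hRt := sqrt_pos.2 (offRad_pos A.hs A.hp x)
    have : (offOrbit s e p β σ x).1 * cos (σ * x) - (offOrbit s e p β σ x).2.1 * sin (σ * x) =
        (e * β * √(offRad s p x) * cos x ^ 2 + 2 * e * s * sin x ^ 2) / offDen s p x := by
      rw [e1, e2]
      simp only [offOrbit]
      field_simp
      rw [hσ]
      ring
    rw [this]
    have := A.hs
    have := A.hb
    have := A.he
    refine div_pos ?_ hD
    rcases eq_or_ne (sin x) 0 with h0 | h0
    · have hcc := sin_sq_add_cos_sq x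
      have h1 : cos x ≠ 0 := fun h1 => by rw [h0, h1] at hcc; norm_num at hcc
      positivity
    · positivity
  · rw [e1, e2, hb]
    simp only [offOrbit, hb]
    ring

end

section

variable {I₁ I₂ I₃ l h γ δ κ : ℝ} {q : Motion} {a b s e p β σ ε : ℝ}

/-- Stage 2 leads along a quarter of the rotor-on orbit, to the point of maximal tilt. -/
theorem rotor_on_stage_to_maximum (A : TwistConstants γ δ s e p β) (hκ₀ : 2 * κ * e = γ * s ^ 2)
    (hε : ε ^ 2 = 1) (h₁ : 0 < I₁) (h₂ : I₂ ≠ 0) (h₃ : I₃ ≠ 0)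
    (hl : 0 < l) (hδ : δ = I₁ / I₂ - 1) (hγ : γ = I₁ / I₃ - 1) (hκ : ε * κ = h / l * (I₁ / I₂))
    (H : SolvesMotion I₁ I₂ I₃ l h q (Icc a b)) (hab : a ≤ b)
    (hθ : |q.theta a| < π / 2) (hψ : q.psi a = 0)
    (ha : bodyDirection (q.theta a) (q.psi a) = (1, 0, 0))
    (hmax : IsGreatest (orbitTilts I₁ I₂ I₃ l h (q.theta b) (q.psi b)) |q.theta b|)
    (hfirst : ∀ t ∈ Ico a b, |q.theta t| < |q.theta b|) :
    bodyDirection (q.theta b) (q.psi b) = (0, ε * e, -ε * p) ∧ |q.theta b| < π / 2 ∧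
      q.psi b = -ε * (π / 2) ∧ l / I₁ * (b - a) = T₂hat γ (δ / γ) s ∧
      q.phi b - q.phi a = φ₂ γ (δ / γ) s := by
  have hσ : (-ε) ^ 2 = 1 := by rw [neg_sq, hε]
  have hU := isEulerOrbit_onOrbit A hσ hε hκ₀
  have hp := A.hp
  have hc : cos (-(π / 2)) = 0 := by rw [cos_neg, cos_pi_div_two]
  obtain ⟨α, hαa, F⟩ := H.follows h₁ h₂ h₃ hl hδ hγ hκ hU (left_mem_Icc.2 hab)
    (t₀ := -(π / 2)) (by
      rw [ha, onOrbit_of_cos_eq_zero A _ _ hc, sin_neg, sin_pi_div_two]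
      congr 1; linear_combination -hε)
  have hθ' := F.abs_theta_lt hU H (left_mem_Icc.2 hab) hθ
  have hb := right_mem_Icc.2 hab
  have hab' : -(π / 2) ≤ α b := by rw [← hαa]; exact F.strictMono.monotone hab
  rw [orbitTilts_eq h₁ h₂ h₃ hl hδ hγ hκ hU (hθ' b hb) (F.eq b hb)] at hmax
  have h0 : arcsin |(onOrbit s e p (-ε) ε 0).2.2| = arcsin p := by
    rw [onOrbit_zero A]
    simp only
    congr 1
    rw [abs_mul, abs_of_pos hp, abs_neg, (abs_eq zero_le_one).2 (by simpa using hε), one_mul]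
  have hle : arcsin p ≤ |q.theta b| := hmax.2 ⟨0, h0⟩
  have hsin : sin (α b) = 0 := by
    rw [F.abs_theta_eq hb (hθ' b hb)] at hle
    have h1 := (strictMonoOn_arcsin.le_iff_le ⟨by linarith, A.p_lt_one.le⟩
      ⟨by linarith [abs_nonneg (onOrbit s e p (-ε) ε (α b)).2.2],
        (sq_le_one_iff_abs_le_one _).1 (hU.pole _).le⟩).1 hle
    have h2 := h1.trans (abs_onOrbit_le A hσ ε (α b))
    have h3 : 1 ≤ |cos (α b)| := le_of_mul_le_mul_left (by rwa [mul_one]) hp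
    have h4 : 1 ≤ cos (α b) ^ 2 := by
      rw [← sq_abs]; nlinarith
    have := sin_sq_add_cos_sq (α b)
    exact pow_eq_zero_iff two_ne_zero |>.1 (by nlinarith [sq_nonneg (sin (α b))])
  have hαb : α b = 0 := by
    rcases le_or_gt (α b) 0 with h5 | h5
    · exact (sin_eq_zero_iff_of_lt_of_lt (by linarith [pi_pos]) (by linarith [pi_pos])).1 hsin
    · -- otherwise the maximal tilt would have occurred before
      obtain ⟨τ, hτ⟩ := F.surjective 0
      have hτa : a < τ := F.strictMono.lt_iff_lt.1 (by rw [hτ, hαa]; linarith [pi_pos])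
      have hτb : τ < b := F.strictMono.lt_iff_lt.1 (by rwa [hτ])
      have h6 := hfirst τ ⟨hτa.le, hτb⟩
      rw [F.abs_theta_eq ⟨hτa.le, hτb.le⟩ (hθ' τ ⟨hτa.le, hτb.le⟩), hτ, h0] at h6
      have h7 := hmax.1
      obtain ⟨x, hx⟩ := h7
      have h8 : |q.theta b| ≤ arcsin p := by
        rw [← hx]
        refine monotone_arcsin ((abs_onOrbit_le A hσ ε x).trans ?_)
        exact mul_le_of_le_one_right hp.le (abs_cos_le_one x)
      linarith
  have hdir := F.eq b hb
  rw [hαb, onOrbit_zero A] at hdir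
  have even1 : ∀ x, (onClock γ s e p (-x))⁻¹ = (onClock γ s e p x)⁻¹ := fun x => by
    simp only [onClock, onRad, cos_neg, sin_neg, neg_sq]
  have even2 : ∀ x, somersaultRate δ (ε * κ) (onOrbit s e p (-ε) ε (-x)) =
      somersaultRate δ (ε * κ) (onOrbit s e p (-ε) ε x) := fun x => by
    simp only [somersaultRate, onOrbit, onDen, cos_neg, sin_neg, neg_sq]
  refine ⟨hdir, hθ' b hb, ?_, ?_, ?_⟩
  · have hε' : ε = 1 ∨ ε = -1 := by simpa using hε
    have := psi_eq_of_follows_onOrbit A hσ hε F H hab hθ' (ψ₀ := -ε * (π / 2))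
      (by rcases hε' with rfl | rfl <;> simp) (by rcases hε' with rfl | rfl <;> simp)
      hαa.ge (by rw [hαb]; positivity) (by rw [hψ, hαa]; ring) (by rw [hsin, zero_mul])
    rw [this, hαb]
    ring
  · rw [F.duration hU hab, hαa, hαb, ← integral_onClock_inv A]
    have e := intervalIntegral.integral_comp_neg (f := fun x => (onClock γ s e p x)⁻¹)
      (a := 0) (b := π / 2)
    rw [neg_zero] at e
    rw [← e]
    simp only [even1]
  · rw [F.somersault hU h₁.ne' h₂ hl.ne' hδ hκ H hab, hαa, hαb,
      ← integral_onOrbit_rate A hσ hε hκ₀]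
    have e := intervalIntegral.integral_comp_neg (f := fun x =>
      somersaultRate δ (ε * κ) (onOrbit s e p (-ε) ε x) * (onClock γ s e p x)⁻¹)
      (a := 0) (b := π / 2)
    rw [neg_zero] at e
    rw [← e]
    simp only [even1, even2]

/-- Stage 4 leads along a quarter of a rotor-on orbit, from the point of maximal tilt to pure
somersaulting. -/
theorem rotor_on_stage_from_maximum (A : TwistConstants γ δ s e p β)
    (hκ₀ : 2 * κ * e = γ * s ^ 2) (hσ : σ ^ 2 = 1)
    (hε : ε ^ 2 = 1) (h₁ : 0 < I₁) (h₂ : I₂ ≠ 0) (h₃ : I₃ ≠ 0)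
    (hl : 0 < l) (hδ : δ = I₁ / I₂ - 1) (hγ : γ = I₁ / I₃ - 1) (hκ : ε * κ = h / l * (I₁ / I₂))
    (H : SolvesMotion I₁ I₂ I₃ l h q (Icc a b)) (hab : a ≤ b)
    (hθ : |q.theta a| < π / 2)
    (ha : bodyDirection (q.theta a) (q.psi a) = (0, ε * e, σ * p))
    (hend : IsPureSomersault l (q.theta b) (q.psi b))
    (hfirst : ∀ t ∈ Ico a b, ¬ IsPureSomersault l (q.theta t) (q.psi t)) :
    bodyDirection (q.theta b) (q.psi b) = (σ * ε, 0, 0) ∧ |q.theta b| < π / 2 ∧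
      q.psi b = q.psi a + σ * (π / 2) ∧ l / I₁ * (b - a) = T₂hat γ (δ / γ) s ∧
      q.phi b - q.phi a = φ₂ γ (δ / γ) s := by
  have hU := isEulerOrbit_onOrbit A hσ hε hκ₀
  have hs := A.hs
  have he := A.he
  have hσ' : σ = 1 ∨ σ = -1 := by simpa using hσ
  have hε' : ε = 1 ∨ ε = -1 := by simpa using hε
  obtain ⟨α, hαa, F⟩ := H.follows h₁ h₂ h₃ hl hδ hγ hκ hU (left_mem_Icc.2 hab)
    (t₀ := 0) (by rw [ha, onOrbit_zero A])
  have hθ' := F.abs_theta_lt hU H (left_mem_Icc.2 hab) hθ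
  have hb := right_mem_Icc.2 hab
  have hab' : 0 ≤ α b := by rw [← hαa]; exact F.strictMono.monotone hab
  have hdir : onOrbit s e p σ ε (π / 2) = (σ * ε, 0, 0) := by
    rw [onOrbit_of_cos_eq_zero A _ _ cos_pi_div_two, sin_pi_div_two, mul_one]
  have hcos : cos (α b) = 0 := by
    rw [isPureSomersault_iff hl.ne', F.eq b hb] at hend
    have h2 : (onOrbit s e p σ ε (α b)).2.1 = 0 := by rcases hend with h | h <;> rw [h]
    have hD := onDen_pos hs A.hp (α b)
    have hε0 : ε ≠ 0 := by rcases hε' with rfl | rfl <;> norm_num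
    simp only [onOrbit] at h2
    field_simp at h2
    simpa [hε0, he.ne', hs.ne'] using h2
  have hαb : α b = π / 2 := by
    rcases le_or_gt (α b) (π / 2) with h5 | h5
    · rcases h5.eq_or_lt with h6 | h6
      · exact h6
      · exact absurd hcos (cos_pos_of_mem_Ioo ⟨by linarith [pi_pos], h6⟩).ne'
    · -- otherwise pure somersaulting would have been reached before
      obtain ⟨τ, hτ⟩ := F.surjective (π / 2)
      have hτa : a < τ := F.strictMono.lt_iff_lt.1 (by rw [hτ, hαa]; positivity)
      have hτb : τ < b := F.strictMono.lt_iff_lt.1 (by rwa [hτ])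
      refine absurd ?_ (hfirst τ ⟨hτa.le, hτb⟩)
      rw [isPureSomersault_iff hl.ne', F.eq τ ⟨hτa.le, hτb.le⟩, hτ, hdir]
      rcases hσ' with rfl | rfl <;> rcases hε' with rfl | rfl <;> simp
  refine ⟨by rw [F.eq b hb, hαb, hdir], hθ' b hb, ?_, ?_, ?_⟩
  · have hca : 0 < cos (q.theta a) := cos_pos_of_mem_Ioo (abs_lt.1 hθ)
    simp only [bodyDirection, Prod.mk.injEq] at ha
    obtain ⟨e1, e2, -⟩ := ha
    have c0 : cos (q.psi a) = 0 := (mul_eq_zero.1 e1).resolve_left hca.ne'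
    have s1 : sin (q.psi a) = 1 ∨ sin (q.psi a) = -1 := by
      have := sin_sq_add_cos_sq (q.psi a)
      rw [c0] at this
      simpa using this
    have s0 : sin (q.psi a) = -ε := by
      rcases s1 with h | h <;> rcases hε' with rfl | rfl <;> rw [h] at e2 ⊢
      · exfalso; linarith
      · norm_num
      · exfalso; linarith
    have := psi_eq_of_follows_onOrbit A hσ hε F H hab hθ' c0 s0
      (by rw [hαa]; linarith [pi_pos]) hαb.le (by rw [hαa]; ring) (by rw [hcos, mul_zero])
    rw [this, hαb]
  · rw [F.duration hU hab, hαa, hαb, ← integral_onClock_inv A]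
  · rw [F.somersault hU h₁.ne' h₂ hl.ne' hδ hκ H hab, hαa, hαb,
      ← integral_onOrbit_rate A hσ hε hκ₀]

theorem offClock_inv_even (x : ℝ) : (offClock γ β s p (-x))⁻¹ = (offClock γ β s p x)⁻¹ := by
  simp only [offClock, offRad, sin_neg, neg_sq]

theorem offClock_inv_periodic : Function.Periodic (fun x => (offClock γ β s p x)⁻¹) π := fun x => by
  simp only [offClock, offRad, sin_add_pi, neg_sq]

theorem offOrbit_rate_even (x : ℝ) : somersaultRate δ 0 (offOrbit s e p β σ (-x)) =
    somersaultRate δ 0 (offOrbit s e p β σ x) := by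
  simp only [somersaultRate, offOrbit, offDen, sin_neg, neg_sq, mul_neg, neg_div, neg_zero, zero_mul]

theorem offOrbit_rate_periodic :
    Function.Periodic (fun x => somersaultRate δ 0 (offOrbit s e p β σ x)) π := fun x => by
  simp only [somersaultRate, offOrbit, offDen, sin_add_pi, neg_sq, mul_neg, neg_div, neg_zero,
    zero_mul]

/-- Time and somersault angle of `k` half periods of the rotor-off orbit. -/
theorem Follows.off_half_periods {α : ℝ → ℝ} (A : TwistConstants γ δ s e p β) (hσ : σ ^ 2 = 1)
    (h₁ : 0 < I₁) (h₂ : I₂ ≠ 0) (hl : 0 < l) (hδ : δ = I₁ / I₂ - 1)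
    (F : Follows q (l / I₁) (offOrbit s e p β σ) (offClock γ β s p) α a b)
    (H : SolvesMotion I₁ I₂ I₃ l 0 q (Icc a b)) (hab : a ≤ b) (k : ℕ) (hk : α b = α a + k * π) :
    l / I₁ * (b - a) = k / 2 * P₃hat γ (δ / γ) s ∧
      q.phi b - q.phi a = k / 2 * Φ₃ γ (δ / γ) s := by
  have hU := isEulerOrbit_offOrbit A hσ
  have c1 : Continuous fun t => (offClock γ β s p t)⁻¹ :=
    hU.clock_continuous.inv₀ fun t => (hU.clock_pos t).ne'
  have hκ : (0 : ℝ) = 0 / l * (I₁ / I₂) := by simp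
  constructor
  · rw [F.duration hU hab, hk, integral_even_periodic c1 offClock_inv_even offClock_inv_periodic,
      integral_offClock_inv A]
    ring
  · rw [F.somersault hU h₁.ne' h₂ hl.ne' hδ hκ H hab, hk,
      integral_even_periodic
        (g := fun x => somersaultRate δ 0 (offOrbit s e p β σ x) * (offClock γ β s p x)⁻¹)
        (hU.continuous_somersaultRate.mul c1) (fun x => by rw [offClock_inv_even, offOrbit_rate_even])
        (offOrbit_rate_periodic.mul offClock_inv_periodic), integral_offOrbit_rate A hσ]
    ring

/-- Stage 3 takes a whole number of half periods, if it ends at a point of maximal tilt. -/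
theorem rotor_off_stage (A : TwistConstants γ δ s e p β) (hσ : σ ^ 2 = 1)
    (h₁ : 0 < I₁) (h₂ : I₂ ≠ 0) (h₃ : I₃ ≠ 0)
    (hl : 0 < l) (hδ : δ = I₁ / I₂ - 1) (hγ : γ = I₁ / I₃ - 1)
    (H : SolvesMotion I₁ I₂ I₃ l 0 q (Icc a b)) (hab : a ≤ b)
    (hθ : |q.theta a| < π / 2) (hψ : q.psi a = σ * (π / 2))
    (ha : bodyDirection (q.theta a) (q.psi a) = (0, -(σ * e), σ * p))
    (hb : (bodyDirection (q.theta b) (q.psi b)).2.1 ^ 2 = e ^ 2) :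
    ∃ k : ℕ, |q.theta b| < π / 2 ∧ q.psi b = σ * (π / 2 + k * π) ∧
      (bodyDirection (q.theta b) (q.psi b)).1 = 0 ∧
      (bodyDirection (q.theta b) (q.psi b)).2.2 = σ * p ∧
      l / I₁ * (b - a) = k / 2 * P₃hat γ (δ / γ) s ∧
      q.phi b - q.phi a = k / 2 * Φ₃ γ (δ / γ) s := by
  have hU := isEulerOrbit_offOrbit A hσ
  have hκ : (0 : ℝ) = 0 / l * (I₁ / I₂) := by simp
  obtain ⟨α, hαa, F⟩ := H.follows h₁ h₂ h₃ hl hδ hγ hκ hU (left_mem_Icc.2 hab)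
    (t₀ := π / 2) (by rw [ha, offOrbit_of_cos_eq_zero A _ cos_pi_div_two, sin_pi_div_two, mul_one])
  have hθ' := F.abs_theta_lt hU H (left_mem_Icc.2 hab) hθ
  have hbm := right_mem_Icc.2 hab
  have hs := A.hs
  have hp := A.hp
  have he := A.he
  have hcos : cos (α b) = 0 := by
    rw [F.eq b hbm] at hb
    have hD := offDen_pos hs hp (α b)
    simp only [offOrbit] at hb
    rw [neg_sq, div_pow, div_eq_iff (by positivity)] at hb
    have h1 : (2 * s * sin (α b)) ^ 2 = offDen s p (α b) ^ 2 := by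
      have : e ^ 2 * ((2 * s * sin (α b)) ^ 2 - offDen s p (α b) ^ 2) = 0 := by
        linear_combination hb - (2 * e * s * sin (α b)) ^ 2 * hσ
      linarith [(mul_eq_zero.1 this).resolve_left (by positivity)]
    have h2 : |2 * s * sin (α b)| = |offDen s p (α b)| := sq_eq_sq_iff_abs_eq_abs _ _ |>.1 h1
    rw [abs_of_pos hD, abs_mul, abs_of_pos (by positivity), offDen, ← sq_abs (sin _)] at h2
    have h3 := abs_sin_le_one (α b)
    have h4 := abs_nonneg (sin (α b))
    have h5 : (1 - |sin (α b)|) * (p * (1 + |sin (α b)|) + s * (1 - |sin (α b)|)) = 0 := by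
      linear_combination -h2
    have h6 : |sin (α b)| = 1 := by
      have h7 : 0 < p * (1 + |sin (α b)|) + s * (1 - |sin (α b)|) := by
        have := mul_nonneg hs.le (sub_nonneg.2 h3)
        positivity
      linarith [(mul_eq_zero.1 h5).resolve_right h7.ne']
    have := sin_sq_add_cos_sq (α b)
    rw [← sq_abs (sin _), h6] at this
    exact pow_eq_zero_iff two_ne_zero |>.1 (by linarith)
  obtain ⟨k, hk⟩ := cos_eq_zero_iff.1 hcos
  have hk0 : 0 ≤ k := by
    have h1 : π / 2 ≤ α b := by rw [← hαa]; exact F.strictMono.monotone hab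
    rw [hk] at h1
    have h2 : (0 : ℝ) ≤ k := by
      by_contra! h3
      nlinarith [pi_pos]
    exact_mod_cast h2
  lift k to ℕ using hk0
  rw [Int.cast_natCast] at hk
  have hk' : α b = α a + k * π := by rw [hk, hαa]; ring
  have hfin := F.off_half_periods A hσ h₁ h₂ hl hδ H hab k hk'
  have hdir := F.eq b hbm
  rw [offOrbit_of_cos_eq_zero A _ hcos] at hdir
  refine ⟨k, hθ' b hbm, ?_, by rw [hdir], by rw [hdir], hfin⟩
  rw [psi_eq_of_follows_offOrbit A hσ F H hab hθ' (by rw [hψ, hαa]) hcos, hk', hαa]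

/-- Period of the momentum direction along the rotor-off orbit, and the somersault angle in a
period. -/
theorem twist_period (A : TwistConstants γ δ s e p β) (hσ : σ ^ 2 = 1)
    (h₁ : 0 < I₁) (h₂ : I₂ ≠ 0) (h₃ : I₃ ≠ 0)
    (hl : 0 < l) (hδ : δ = I₁ / I₂ - 1) (hγ : γ = I₁ / I₃ - 1) {θ₀ ψ₀ t₀ P Φ : ℝ}
    (ht₀ : bodyDirection θ₀ ψ₀ = offOrbit s e p β σ t₀)
    (hP : IsTwistPeriod I₁ I₂ I₃ l θ₀ ψ₀ P Φ) :
    l / I₁ * P = P₃hat γ (δ / γ) s ∧ Φ = Φ₃ γ (δ / γ) s := by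
  obtain ⟨hP0, q, a, H, ⟨c, hc, hcθ, hcψ⟩, hret, hne, rfl⟩ := hP
  have hU := isEulerOrbit_offOrbit A hσ
  have hκ : (0 : ℝ) = 0 / l * (I₁ / I₂) := by simp
  obtain ⟨α, -, F⟩ := H.follows h₁ h₂ h₃ hl hδ hγ hκ hU hc (by rw [hcθ, hcψ, ht₀])
  have hab : a ≤ a + P := by linarith
  simp only [ne_eq, bodyMomentum_eq_iff hl.ne'] at hret hne
  rw [F.eq _ (left_mem_Icc.2 hab), F.eq _ (right_mem_Icc.2 hab)] at hret
  obtain ⟨k, hk⟩ := offOrbit_injective A hσ hret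
  have hlt : α a < α (a + P) := F.strictMono (by linarith)
  have hk1 : 1 ≤ k := by
    by_contra! h0
    have h1 : (k : ℝ) ≤ 0 := by exact_mod_cast (by omega : k ≤ 0)
    nlinarith [pi_pos]
  have hk2 : k ≤ 1 := by
    by_contra! h0
    have h1 : (1 : ℝ) < k := by exact_mod_cast h0
    -- the momentum direction would have returned before
    obtain ⟨τ, hτ⟩ := F.surjective (α a + 2 * π)
    have hτa : a < τ := F.strictMono.lt_iff_lt.1 (by rw [hτ]; linarith [pi_pos])
    have hτb : τ < a + P := F.strictMono.lt_iff_lt.1 (by rw [hτ, hk]; nlinarith [pi_pos])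
    refine hne τ ⟨hτa, hτb⟩ ?_
    rw [F.eq τ ⟨hτa.le, hτb.le⟩, F.eq a (left_mem_Icc.2 hab), hτ]
    simp only [offOrbit, offRad, offDen, sin_add_two_pi, cos_add_two_pi]
  have hk3 : α (a + P) = α a + (2 : ℕ) * π := by
    rw [hk, le_antisymm hk2 hk1]; push_cast; ring
  have := F.off_half_periods A hσ h₁ h₂ hl hδ H hab 2 hk3
  simpa using this

end

end TwistingSomersault

theorem mainTheorem2 (I₁ I₂ I₃ l h : ℝ) (hI₃ : 0 < I₃) (hI₃₁ : I₃ < I₁) (hI₁₂ : I₁ < I₂)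
    (hl : 0 < l) (hh : h ≠ 0)
    (δ γ ν : ℝ) (hδ : δ = I₁ / I₂ - 1) (hγ : γ = I₁ / I₃ - 1) (hν : ν = δ / γ)
    (m n : ℝ) (D : Dive I₁ I₂ I₃ l h) (hD : D.Performs m n)
    (θmin θmax : ℝ)
    (hmin : IsLeast (orbitTilts I₁ I₂ I₃ l 0 (D.q.theta D.t₂) (D.q.psi D.t₂)) θmin)
    (hmax : IsGreatest (orbitTilts I₁ I₂ I₃ l 0 (D.q.theta D.t₂) (D.q.psi D.t₂)) θmax)
    (s : ℝ) (hs : s = sin θmin) :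
    0 < s ∧ s < 1 ∧ sin θmax ^ 2 + (1 - sin θmax ^ 2) * ν = s ^ 2 ∧
    l / I₁ * (D.t₂ - D.t₁) = T₂hat γ ν s ∧
    D.q.phi D.t₂ - D.q.phi D.t₁ = φ₂ γ ν s ∧
    (∀ P Φ : ℝ, IsTwistPeriod I₁ I₂ I₃ l (D.q.theta D.t₂) (D.q.psi D.t₂) P Φ →
      l / I₁ * P = P₃hat γ ν s ∧ Φ = Φ₃ γ ν s) ∧
    l / I₁ * D.Ttot - 2 * m * π =
      2 * (T₂hat γ ν s - φ₂ γ ν s) + (P₃hat γ ν s - Φ₃ γ ν s) * (n - 1 / 2) ∧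
    2 * (l / I₁ * D.t₁) = 2 * m * π - 2 * φ₂ γ ν s - Φ₃ γ ν s * (n - 1 / 2) ∧
    2 * m * π - 2 * φ₂ γ ν s - Φ₃ γ ν s * (n - 1 / 2) ≥ 0 := by
  have h₁ : 0 < I₁ := hI₃.trans hI₃₁
  have h₂ : 0 < I₂ := h₁.trans hI₁₂
  have hγ0 : 0 < γ := by rw [hγ, sub_pos, one_lt_div hI₃]; exact hI₃₁
  have hδ0 : δ < 0 := by rw [hδ, sub_neg, div_lt_one h₂]; exact hI₁₂
  -- the rotor momentum as a sign `ε` and a size `κ`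
  obtain ⟨ε, κ, hε, hκ0, hεκ⟩ : ∃ ε κ : ℝ, ε ^ 2 = 1 ∧ 0 < κ ∧ ε * κ = h / l * (I₁ / I₂) := by
    have hr : 0 < I₁ / I₂ := div_pos h₁ h₂
    rcases lt_or_gt_of_ne hh with hneg | hpos
    · exact ⟨-1, -h / l * (I₁ / I₂), by norm_num, mul_pos (div_pos (neg_pos.2 hneg) hl) hr, by ring⟩
    · exact ⟨1, h / l * (I₁ / I₂), by norm_num, mul_pos (div_pos hpos hl) hr, by ring⟩
  obtain ⟨s', e, p, b, A, hκ₀⟩ := exists_twistConstants hγ0 hδ0 hκ0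
  have he := A.he
  have hε' : ε = 1 ∨ ε = -1 := by simpa using hε
  have hσ : (-ε) ^ 2 = 1 := by rw [neg_sq, hε]
  have h0κ : (0 : ℝ) = 0 / l * (I₁ / I₂) := by simp
  have h₂' := h₂.ne'
  have h₃' := hI₃.ne'
  -- stage 1
  obtain ⟨d1, a1, ψ1, φ1⟩ := pure_somersault_stage h₁ h₂' h₃' hl hδ hγ D.stage₁ D.t₁_nonneg
    (one_pow 2) (by rw [D.theta_start, abs_zero]; positivity)
    (by rw [D.theta_start, D.psi_start]; simp [bodyDirection])
  -- stage 2
  obtain ⟨d2, a2, ψ2, T2, φ2⟩ := rotor_on_stage_to_maximum A hκ₀ hε h₁ h₂' h₃' hl hδ hγ hεκ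
    D.stage₂ D.t₁_le_t₂ a1 (by rw [ψ1, D.psi_start]) d1 D.stage₂_max D.stage₂_first
  have hpt : bodyDirection (D.q.theta D.t₂) (D.q.psi D.t₂) = offOrbit s' e p b (-ε) (π / 2) := by
    rw [d2, offOrbit_of_cos_eq_zero A _ cos_pi_div_two, sin_pi_div_two, mul_one, neg_mul, neg_mul,
      neg_neg]
  have hU3 := isEulerOrbit_offOrbit A hσ
  rw [orbitTilts_eq h₁ h₂' h₃' hl hδ hγ h0κ hU3 a2 hpt] at hmin hmax
  have hs' : s = s' := by
    rw [hs, hmin.unique (isLeast_offOrbit A hσ), sin_arcsin (by linarith [A.hs]) A.s_lt_one.le]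
  have hsp : sin θmax = p := by
    rw [hmax.unique (isGreatest_offOrbit A hσ), sin_arcsin (by linarith [A.hp]) A.p_lt_one.le]
  subst hs' hν
  -- stage 3 ends where the energies with and without the rotor of stage 4 agree
  obtain ⟨h₄, hh₄, H4⟩ := D.stage₄
  obtain ⟨ε₄, hε₄, hεκ₄⟩ : ∃ ε₄ : ℝ, ε₄ ^ 2 = 1 ∧ ε₄ * κ = h₄ / l * (I₁ / I₂) := by
    rcases hh₄ with rfl | rfl
    · exact ⟨ε, hε, hεκ⟩
    · exact ⟨-ε, hσ, by rw [neg_mul, hεκ]; ring⟩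
  have E3 := energy_eq h₁.ne' h₂' h₃' hl.ne' hδ hγ h0κ D.stage₃ D.t₂_le_t₃ d2 rfl
  have u2 : (bodyDirection (D.q.theta D.t₃) (D.q.psi D.t₃)).2.1 = ε₄ * e := by
    have E4 : γ * (bodyDirection (D.q.theta D.t₃) (D.q.psi D.t₃)).2.2 ^ 2 +
        δ * (bodyDirection (D.q.theta D.t₃) (D.q.psi D.t₃)).2.1 ^ 2 -
        2 * (ε₄ * κ) * (bodyDirection (D.q.theta D.t₃) (D.q.psi D.t₃)).2.1 = 0 := by
      rcases (isPureSomersault_iff hl.ne' _ _).1 D.stage₄_end with h | h <;>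
      simpa using energy_eq h₁.ne' h₂' h₃' hl.ne' hδ hγ hεκ₄ H4 D.t₃_le_t₄ rfl h
    have E : 2 * κ * (ε₄ * (bodyDirection (D.q.theta D.t₃) (D.q.psi D.t₃)).2.1 - e) = 0 := by
      have := A.p_sq_sub_s_sq
      simp only [mul_zero, zero_mul, sub_zero] at E3
      linear_combination -E4 - E3 - hκ₀ + this + (γ * p ^ 2 + δ * e ^ 2) * hε
    have E' := (mul_eq_zero.1 E).resolve_left (by positivity)
    linear_combination ε₄ * E' -
      (bodyDirection (D.q.theta D.t₃) (D.q.psi D.t₃)).2.1 * hε₄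
  obtain ⟨k, a3, ψ3, u1, u3, T3, φ3⟩ := rotor_off_stage A hσ h₁ h₂' h₃' hl hδ hγ D.stage₃
    D.t₂_le_t₃ a2 ψ2 (by rw [d2, neg_mul ε e, neg_neg]) (by rw [u2, mul_pow, hε₄, one_mul])
  -- stages 4 and 5
  obtain ⟨d4, a4, ψ4, T4, φ4⟩ := rotor_on_stage_from_maximum A hκ₀ hσ hε₄ h₁ h₂' h₃' hl hδ hγ hεκ₄
    H4 D.t₃_le_t₄ a3 (Prod.ext u1 (Prod.ext u2 u3)) D.stage₄_end D.stage₄_first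
  have ht5 : D.t₄ ≤ D.Ttot := by linarith [D.stage₅_duration, D.t₁_nonneg]
  obtain ⟨-, -, ψ5, φ5⟩ := pure_somersault_stage h₁ h₂' h₃' hl hδ hγ D.stage₅ ht5
    (by rw [mul_pow, hσ, hε₄, one_mul]) a4 d4
  obtain ⟨hm, hn⟩ := hD
  -- the number of twists
  have hn' : n - 1 / 2 = k / 2 := by
    have e1 : D.q.psi D.Ttot - D.q.psi 0 = -ε * ((k + 1) * π) := by
      rw [ψ5, ψ4, ψ3, D.psi_start]; ring
    have e2 : |(-ε : ℝ)| = 1 := by rw [abs_neg]; rcases hε' with rfl | rfl <;> simp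
    rw [e1, abs_mul, e2, one_mul, abs_of_nonneg (by positivity)] at hn
    have : (k + 1 : ℝ) = 2 * n := mul_right_cancel₀ pi_ne_zero hn
    linarith
  rw [D.stage₅_duration] at φ5
  rw [sub_zero] at φ1
  have hT1 : 2 * (l / I₁ * D.t₁) =
      2 * m * π - 2 * φ₂ γ (δ / γ) s - Φ₃ γ (δ / γ) s * (n - 1 / 2) := by
    rw [hn']
    linarith
  refine ⟨A.hs, A.s_lt_one, ?_, T2, φ2, fun P Φ hP =>
    twist_period A hσ h₁ h₂' h₃' hl hδ hγ hpt hP, ?_, hT1, ?_⟩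
  · rw [hsp]
    field_simp
    linear_combination A.p_sq_sub_s_sq - δ * A.p_sq
  · have e5 : D.Ttot = D.t₄ + D.t₁ := by linarith [D.stage₅_duration]
    have : l / I₁ * D.Ttot = 2 * (l / I₁ * D.t₁) + l / I₁ * (D.t₂ - D.t₁) +
        l / I₁ * (D.t₃ - D.t₂) + l / I₁ * (D.t₄ - D.t₃) := by
      rw [e5]; ring
    rw [this, T2, T3, T4, hT1, hn']
    ring
  · rw [← hT1]
    have := D.t₁_nonneg
    positivity
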